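/- **Proposition 5.1.** Let $n\ge 3$, let $M$ be a connected smooth $n$-manifold with a smooth Riemannian metric $g$, and let $f:M\to\mathbb R$ be smooth. Write $X=\nabla f$, and let $R$ be the scalar curvature of $g$. Assume: 1. $(M,g,f)$ is an expanding gradient soliton, $2\,\mathrm{Ric}+g=\mathscr L_{X}g$, normalized by $|\nabla f|^2+R=f$, and $g$ has positive sectional curvature. 2. $(M,g,f)$ is asymptotically conical as a soliton: there are $r_0\ge 0$ and a map $F:(r_0,\infty)\times S^{n-1}\to M$ which is a diffeomorphism onto an open set with compact complement in $M$, such that $f(F(r,\omega))=r^2/4$ and $\partial F/\partial r=\sqrt f\,X/|X|^2$; and there are $\alpha\in[0,1)$ and $\varepsilon>0$ such that $F^*g=g_\alpha+k$, where $g_\alpha=dr^2+(1-\alpha)r^2g_{S^{n-1}}$ and $|\nabla^jk|=O(r^{-3\varepsilon-j})$ as $r\to\infty$ for $j=0,1,2$ (with the norm and the Levi-Civita connection of $g_\alpha$). Let $h$ be a symmetric $(0,2)$-tensor on $M$ of class $C^2$ (for instance, a smooth one) such that $$\Delta_L h+\mathscr L_X h-h=0,$$ where, for an orthonormal basis $e_1,\dots,e_n$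 of a tangent space, $$(\Delta_Lh)(e_i,e_k)=(\Delta h)(e_i,e_k)+2\sum_{j,l=1}^nR(e_i,e_j,e_k,e_l)\,h(e_j,e_l)-h(\mathrm{Ric}(e_i),e_k)-h(e_i,\mathrm{Ric}(e_k)),$$ $\Delta$ is the connection Laplacian $-\nabla^*\nabla$, and the sign of the curvature tensor is such that $R(u,v,u,v)>0$ in positive sectional curvature. Suppose that $|h|=o(1)$ at infinity, i.e. for every $\delta>0$ there is a compact set outside of which $|h|<\delta$. Then $h\equiv 0$. -/

import Mathlib

open scoped Manifold ContDiff Topology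
open Bundle Filter Asymptotics Bornology

noncomputable section

namespace ExpSoliton

/-! ### Tensor calculus in local coordinates

`G : Euc n → Matrix (Fin n) (Fin n) ℝ` denotes the matrix `(g_ij)` of a Riemannian metric on an
open subset of `ℝⁿ`. All the operators below only depend on the germs of their arguments. -/

/-- The coordinate space `ℝⁿ`. -/
abbrev Euc (n : ℕ) : Type := EuclideanSpace ℝ (Fin n)

variable {n : ℕ}

/-- Partial derivative `∂_i u`. -/
def pd (i : Fin n) (u : Euc n → ℝ) (x : Euc n) : ℝ :=
  fderiv ℝ u x (EuclideanSpace.single i 1)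

/-- Christoffel symbols `Γ^k_ij = ½ g^{kl} (∂_i g_jl + ∂_j g_il - ∂_l g_ij)` of the Levi-Civita
connection. -/
def christoffel (G : Euc n → Matrix (Fin n) (Fin n) ℝ) (k i j : Fin n) (x : Euc n) : ℝ :=
  (1 / 2) * ∑ l, (G x)⁻¹ k l *
    (pd i (fun y => G y j l) x + pd j (fun y => G y i l) x - pd l (fun y => G y i j) x)

/-- The `(0,4)` curvature tensor `R_ijkl = R(∂_i, ∂_j, ∂_k, ∂_l) = g(Rm(∂_i, ∂_j) ∂_l, ∂_k)` where
`Rm(X, Y) = D_X D_Y - D_Y D_X - D_[X,Y]`. With this sign convention `R(u, v, u, v)` is positive on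
round spheres. -/
def riemann (G : Euc n → Matrix (Fin n) (Fin n) ℝ) (i j k l : Fin n) (x : Euc n) : ℝ :=
  ∑ m, G x k m * (pd i (christoffel G m j l) x - pd j (christoffel G m i l) x +
    ∑ p, (christoffel G p j l x * christoffel G m i p x -
      christoffel G p i l x * christoffel G m j p x))

/-- Ricci curvature `Ric_ik = g^{jl} R_ijkl`. -/
def ricci (G : Euc n → Matrix (Fin n) (Fin n) ℝ) (i k : Fin n) (x : Euc n) : ℝ :=
  ∑ j, ∑ l, (G x)⁻¹ j l * riemann G i j k l x

/-- Scalar curvature `R = g^{ik} Ric_ik`. -/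
def scalarCurv (G : Euc n → Matrix (Fin n) (Fin n) ℝ) (x : Euc n) : ℝ :=
  ∑ i, ∑ k, (G x)⁻¹ i k * ricci G i k x

/-- Sectional curvature of the plane spanned by the vectors with components `u` and `v`:
`R(u, v, u, v) / (|u|² |v|² - g(u, v)²)`. -/
def sectional (G : Euc n → Matrix (Fin n) (Fin n) ℝ) (u v : Fin n → ℝ) (x : Euc n) : ℝ :=
  (∑ i, ∑ j, ∑ k, ∑ l, riemann G i j k l x * u i * v j * u k * v l) /
    ((∑ i, ∑ j, G x i j * u i * u j) * (∑ i, ∑ j, G x i j * v i * v j) -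
      (∑ i, ∑ j, G x i j * u i * v j) ^ 2)

/-- Components `X^i = g^{ij} ∂_j u` of the gradient of `u`. -/
def grad (G : Euc n → Matrix (Fin n) (Fin n) ℝ) (u : Euc n → ℝ) (i : Fin n) (x : Euc n) : ℝ :=
  ∑ j, (G x)⁻¹ i j * pd j u x

/-- `|∇u|² = g_ij X^i X^j` for `X = ∇u`. -/
def gradNormSq (G : Euc n → Matrix (Fin n) (Fin n) ℝ) (u : Euc n → ℝ) (x : Euc n) : ℝ :=
  ∑ i, ∑ j, G x i j * grad G u i x * grad G u j x

/-- Lie derivative of a `(0,2)`-tensor `T` along the vector field with components `X^k`: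
`(ℒ_X T)_ij = X^k ∂_k T_ij + T_kj ∂_i X^k + T_ik ∂_j X^k`. -/
def lieDeriv (X : Fin n → Euc n → ℝ) (T : Euc n → Matrix (Fin n) (Fin n) ℝ) (i j : Fin n)
    (x : Euc n) : ℝ :=
  ∑ k, (X k x * pd k (fun y => T y i j) x + T x k j * pd i (X k) x + T x i k * pd j (X k) x)

/-- Covariant derivative of a `(0,2)`-tensor: `covDeriv₂ G T i a b = (D_i T)_ab`. -/
def covDeriv₂ (G T : Euc n → Matrix (Fin n) (Fin n) ℝ) (i a b : Fin n) (x : Euc n) : ℝ :=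
  pd i (fun y => T y a b) x -
    ∑ c, (christoffel G c i a x * T x c b + christoffel G c i b x * T x a c)

/-- Second covariant derivative of a `(0,2)`-tensor, i.e. the covariant derivative of the
`(0,3)`-tensor `DT`: `covDeriv₂₂ G T i j a b = (D²_{i,j} T)_ab`. -/
def covDeriv₂₂ (G T : Euc n → Matrix (Fin n) (Fin n) ℝ) (i j a b : Fin n) (x : Euc n) : ℝ :=
  pd i (covDeriv₂ G T j a b) x -
    ∑ c, (christoffel G c i j x * covDeriv₂ G T c a b x +
      christoffel G c i a x * covDeriv₂ G T j c b x +
      christoffel G c i b x * covDeriv₂ G T j a c x)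

/-- Rough (connection) Laplacian `(ΔT)_ab = g^{ij} (D²_{i,j} T)_ab`. -/
def roughLaplacian (G T : Euc n → Matrix (Fin n) (Fin n) ℝ) (a b : Fin n) (x : Euc n) : ℝ :=
  ∑ i, ∑ j, (G x)⁻¹ i j * covDeriv₂₂ G T i j a b x

/-- Lichnerowicz Laplacian
`(Δ_L T)_ik = (ΔT)_ik + 2 R_ijkl T^{jl} - T(Ric(∂_i), ∂_k) - T(∂_i, Ric(∂_k))`, where indices are
raised with `g`. -/
def lichnerowicz (G T : Euc n → Matrix (Fin n) (Fin n) ℝ) (i k : Fin n) (x : Euc n) : ℝ :=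
  roughLaplacian G T i k x +
    2 * (∑ j, ∑ l, ∑ p, ∑ q,
      riemann G i j k l x * (G x)⁻¹ j p * (G x)⁻¹ l q * T x p q) -
    (∑ p, ∑ q, ricci G i p x * (G x)⁻¹ p q * T x q k) -
    (∑ p, ∑ q, ricci G k p x * (G x)⁻¹ p q * T x i q)

/-- Squared norm `g^{aa'} g^{bb'} T_ab T_a'b'` of a `(0,2)`-tensor at a point where the metric has
the matrix `A`. -/
def normSq₂ (A : Matrix (Fin n) (Fin n) ℝ) (T : Fin n → Fin n → ℝ) : ℝ :=
  ∑ a, ∑ b, ∑ a', ∑ b', A⁻¹ a a' * A⁻¹ b b' * T a b * T a' b'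

/-- Squared norm of a `(0,3)`-tensor. -/
def normSq₃ (A : Matrix (Fin n) (Fin n) ℝ) (T : Fin n → Fin n → Fin n → ℝ) : ℝ :=
  ∑ a, ∑ b, ∑ c, ∑ a', ∑ b', ∑ c',
    A⁻¹ a a' * A⁻¹ b b' * A⁻¹ c c' * T a b c * T a' b' c'

/-- Squared norm of a `(0,4)`-tensor. -/
def normSq₄ (A : Matrix (Fin n) (Fin n) ℝ) (T : Fin n → Fin n → Fin n → Fin n → ℝ) : ℝ :=
  ∑ a, ∑ b, ∑ c, ∑ d, ∑ a', ∑ b', ∑ c', ∑ d',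
    A⁻¹ a a' * A⁻¹ b b' * A⁻¹ c c' * A⁻¹ d d' * T a b c d * T a' b' c' d'

/-- The conical metric `g_α = dr² + (1 - α) r² g_{S^{n-1}}` on `ℝⁿ \ {0}`, in Cartesian coordinates:
since `dr = ∑ (x_i / |x|) dx_i` and `dr² + r² g_{S^{n-1}} = ∑ dx_i²`, it equals
`(1 - α) ∑ dx_i² + α dr²`. -/
def coneMetric (α : ℝ) (x : Euc n) : Matrix (Fin n) (Fin n) ℝ :=
  Matrix.of fun i j => (1 - α) * (if i = j then 1 else 0) + α * (x i / ‖x‖) * (x j / ‖x‖)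

/-! ### Tensors on manifolds and their components -/

variable {M : Type*} [TopologicalSpace M] [ChartedSpace (Euc n) M]

/-- A smooth Riemannian metric on the `n`-manifold `M`. -/
abbrev Metric (n : ℕ) (M : Type*) [TopologicalSpace M] [ChartedSpace (Euc n) M]
    [IsManifold (𝓡 n) ∞ M] : Type _ :=
  ContMDiffRiemannianMetric (𝓡 n) ∞ (Euc n) (fun x : M => TangentSpace (𝓡 n) x)

/-- A (not necessarily continuous) `(0,2)`-tensor field on `M`. -/
abbrev Tensor2 (n : ℕ) (M : Type*) [TopologicalSpace M] [ChartedSpace (Euc n) M] : Type _ :=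
  (x : M) → TangentSpace (𝓡 n) x →L[ℝ] TangentSpace (𝓡 n) x →L[ℝ] ℝ

/-- The tensor field `T` is of class `C^k`. -/
def Tensor2.IsOfClass [IsManifold (𝓡 n) ∞ M] (k : ℕ∞) (T : Tensor2 n M) : Prop :=
  ContMDiff (𝓡 n) ((𝓡 n).prod 𝓘(ℝ, Euc n →L[ℝ] Euc n →L[ℝ] ℝ)) k
    (fun x => TotalSpace.mk' (Euc n →L[ℝ] Euc n →L[ℝ] ℝ)
      (E := fun x : M => TangentSpace (𝓡 n) x →L[ℝ] TangentSpace (𝓡 n) x →L[ℝ] ℝ) x (T x))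

/-- The smooth charts of `M`, i.e. all members of the maximal smooth atlas. -/
def smoothCharts (n : ℕ) (M : Type*) [TopologicalSpace M] [ChartedSpace (Euc n) M] :
    Set (OpenPartialHomeomorph M (Euc n)) :=
  IsManifold.maximalAtlas (𝓡 n) ∞ M

/-- The coordinate vector `∂_i` of the chart `φ` at the point with coordinates `y`. -/
def coordVector (φ : OpenPartialHomeomorph M (Euc n)) (y : Euc n) (i : Fin n) :
    TangentSpace (𝓡 n) (φ.symm y) :=
  mfderiv (𝓡 n) (𝓡 n) φ.symm y (EuclideanSpace.single i (1 : ℝ) : Euc n)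

/-- The components `T_ij = T(∂_i, ∂_j)` of a `(0,2)`-tensor field in the chart `φ`, as functions of
the coordinates. -/
def comp (φ : OpenPartialHomeomorph M (Euc n)) (T : Tensor2 n M) (y : Euc n) :
    Matrix (Fin n) (Fin n) ℝ :=
  Matrix.of fun i j => T (φ.symm y) (coordVector φ y i) (coordVector φ y j)

variable [IsManifold (𝓡 n) ∞ M]

/-- The pointwise norm `|T|_g` of a `(0,2)`-tensor field, computed in the preferred chart at the
point (it does not depend on the chart). -/
def tensorNorm (g : Metric n M) (T : Tensor2 n M) (x : M) : ℝ :=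
  √(normSq₂ (comp (chartAt (Euc n) x) g.inner (chartAt (Euc n) x x))
    (comp (chartAt (Euc n) x) T (chartAt (Euc n) x x)))

/-- `(M, g, f)` is an expanding gradient soliton: `f` is smooth and `2 Ric + g = ℒ_{∇f} g`
(an identity of tensors, i.e. it holds in all smooth charts). -/
def IsExpandingGradientSoliton (g : Metric n M) (f : M → ℝ) : Prop :=
  ContMDiff (𝓡 n) 𝓘(ℝ, ℝ) ∞ f ∧
  ∀ φ ∈ smoothCharts n M, ∀ y ∈ φ.target, ∀ i j,
    2 * ricci (comp φ g.inner) i j y + comp φ g.inner y i j =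
      lieDeriv (grad (comp φ g.inner) (f ∘ φ.symm)) (comp φ g.inner) i j y

/-- The normalization `|∇f|² + R = f` of the potential. -/
def IsNormalized (g : Metric n M) (f : M → ℝ) : Prop :=
  ∀ φ ∈ smoothCharts n M, ∀ y ∈ φ.target,
    gradNormSq (comp φ g.inner) (f ∘ φ.symm) y + scalarCurv (comp φ g.inner) y = f (φ.symm y)

/-- All sectional curvatures of `g` are positive. -/
def HasPositiveSectionalCurvature (g : Metric n M) : Prop :=
  ∀ φ ∈ smoothCharts n M, ∀ y ∈ φ.target, ∀ u v : Fin n → ℝ, LinearIndependent ℝ ![u, v] →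
    0 < sectional (comp φ g.inner) u v y

/-- `(M, g, f)` is asymptotically conical as a soliton.

We identify `(r₀, ∞) × S^{n-1}` with `{x ∈ ℝⁿ | |x| > r₀}` through polar coordinates `x = r ω`, so
that `∂/∂r` has the components `x_i / |x|`. A map `F` from this set to `M` which is a diffeomorphism
onto its (open) image is then the same as the inverse `F = φ.symm` of a smooth chart `φ` of `M` with
`φ.target = {|x| > r₀}`, and `F^* g` is the matrix of components of `g` in this chart.

* the complement of the image of `F` is compact;
* `f(F(r, ω)) = r² / 4` and `∂F/∂r = √f X / |X|²` with `X = ∇f`;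
* `F^* g = g_α + k` with `|D^j k| = O(r^{-3ε-j})` as `r → ∞`, for `j = 0, 1, 2`, where `D` and the
  norm are those of `g_α`. -/
def IsAsymptoticallyConical (g : Metric n M) (f : M → ℝ) : Prop :=
  ∃ r₀ : ℝ, 0 ≤ r₀ ∧ ∃ φ ∈ smoothCharts n M,
    φ.target = {x : Euc n | r₀ < ‖x‖} ∧ IsCompact (φ.source)ᶜ ∧
    (∀ x ∈ φ.target, f (φ.symm x) = ‖x‖ ^ 2 / 4) ∧
    (∀ x ∈ φ.target, ∀ i, x i / ‖x‖ =
      √(f (φ.symm x)) * grad (comp φ g.inner) (f ∘ φ.symm) i x /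
        gradNormSq (comp φ g.inner) (f ∘ φ.symm) x) ∧
    ∃ α : ℝ, 0 ≤ α ∧ α < 1 ∧ ∃ k : Euc n → Matrix (Fin n) (Fin n) ℝ,
      (∀ x ∈ φ.target, comp φ g.inner x = coneMetric α x + k x) ∧
      ∃ ε : ℝ, 0 < ε ∧
        (fun x => √(normSq₂ (coneMetric α x) (k x)))
          =O[cobounded (Euc n)] (fun x => ‖x‖ ^ (-(3 * ε))) ∧
        (fun x => √(normSq₃ (coneMetric α x) (fun i a b => covDeriv₂ (coneMetric α) k i a b x)))
          =O[cobounded (Euc n)] (fun x => ‖x‖ ^ (-(3 * ε) - 1)) ∧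
        (fun x => √(normSq₄ (coneMetric α x)
            (fun i j a b => covDeriv₂₂ (coneMetric α) k i j a b x)))
          =O[cobounded (Euc n)] (fun x => ‖x‖ ^ (-(3 * ε) - 2))

/-- `Δ_L h + ℒ_X h - h = 0` with `X = ∇f`. -/
def SolvesLichnerowiczEquation (g : Metric n M) (f : M → ℝ) (h : Tensor2 n M) : Prop :=
  ∀ φ ∈ smoothCharts n M, ∀ y ∈ φ.target, ∀ i j,
    lichnerowicz (comp φ g.inner) (comp φ h) i j y +
      lieDeriv (grad (comp φ g.inner) (f ∘ φ.symm)) (comp φ h) i j y - comp φ h y i j = 0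

end ExpSoliton

end

/-! The proof is a maximum principle for symmetric 2-tensors with an explicit supersolution. Put `P
= Δ_L + ℒ_X - 1` and `B = 2 D²f - g/2`. The soliton equation says `ℒ_X g = 2 D²f`, so `D²f = Ric +
g/2` and `B = 2 Ric + g/2`.

Two computations give `P B = -Ric`. First, `P g = 2 Ric`, because `Δ_L g = 0` and `ℒ_X g - g = 2
Ric` (`solitonOp_metric`). Second, `P (D²f) = 0` (`solitonOp_hess`): the trace of the soliton
equation turns the normalization into `Δf + |∇f|² = f + n/2`, and two derivatives of this scalar
identity, combined with one derivative of the soliton equation, give the claim. Positive sectional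
curvature makes `Ric` positive, so `B ≥ g/2` and `P B < 0`.

Let `θ` be the maximum of `h(v,v) / B(v,v)` over all points and directions. Since `B ≥ g/2`, this
ratio is at most `2|h|`, which tends to zero at infinity; a positive value somewhere therefore
forces a positive maximum `θ`, attained at some point `p` and direction `v`. Then `W = θ B - h` is
nonnegative everywhere and `W(v, ·) = 0` at `p`. Evaluate `P W = -θ Ric` on `(v, v)` in coordinates
normal at `p`. Every term that contracts `W` with `v` vanishes, the first derivatives of `W(v,v)`
vanish, its second derivatives are nonnegative, and the curvature term is the trace of the product
of the nonnegative forms `R(v, ·, v, ·)` and `W`. Hence `-θ Ric(v,v) ≥ 0`, a contradiction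
(`not_touching`). So `h ≤ 0`; the same for `-h` gives `h = 0`.

Local computations are done on jets at the centre of normal coordinates, where the Christoffel
symbols vanish. The supporting facts are that such charts exist (`exists_normal_chart`) and that the
ratio of `h` to `B` does not depend on the chart (`maxEigenvalue_eq`). -/

noncomputable section

namespace ExpSoliton

/-! ### The Hessian of the potential as a solution: the identity between jets -/

section

/-- The algebraic identity behind `Δ_L D²f + ℒ_{∇f} D²f - D²f = 0` on a normalized expanding gradient
soliton, in terms of the jets of the metric and of `f` at the centre of normal coordinates. -/
theorem lichnerowicz_hessian_jet {ι : Type*} [Fintype ι]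
    (G2 : ι → ι → ι → ι → ℝ) (G3 : ι → ι → ι → ι → ι → ℝ)
    (f1 : ι → ℝ) (f2 : ι → ι → ℝ) (f3 : ι → ι → ι → ℝ) (f4 : ι → ι → ι → ι → ℝ)
    (C1 : ι → ι → ι → ι → ℝ) (C2 : ι → ι → ι → ι → ι → ℝ)
    (H1 : ι → ι → ι → ℝ) (H2 : ι → ι → ι → ι → ℝ)
    (hG2 : ∀ i j a b, G2 i j a b = G2 j i a b) (hG2' : ∀ i j a b, G2 i j a b = G2 i j b a)
    (hG3 : ∀ i j k a b, G3 i j k a b = G3 j i k a b)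
    (hG3' : ∀ i j k a b, G3 i j k a b = G3 i k j a b)
    (hG3'' : ∀ i j k a b, G3 i j k a b = G3 i j k b a)
    (hf2 : ∀ i j, f2 i j = f2 j i) (hf3 : ∀ i j k, f3 i j k = f3 j i k)
    (hf3' : ∀ i j k, f3 i j k = f3 i k j)
    (hf4 : ∀ i j k l, f4 i j k l = f4 k l i j)
    (hC1 : ∀ i c a b, C1 i c a b = (1 / 2) * (G2 i a b c + G2 i b a c - G2 i c a b))
    (hC2 : ∀ i j c a b, C2 i j c a b = (1 / 2) * (G3 i j a b c + G3 i j b a c - G3 i j c a b))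
    (hH1 : ∀ i a b, H1 i a b = f3 i a b - ∑ c, C1 i c a b * f1 c)
    (hH2 : ∀ i j a b, H2 i j a b = f4 i j a b -
      ∑ c, (C2 i j c a b * f1 c + C1 i c a b * f2 j c + C1 j c a b * f2 i c))
    (hric : ∀ c a b, ∑ j, (C2 c a b j j - C2 c j b a j) = H1 c a b)
    (hN : ∀ a b, ∑ j, (H2 a b j j + 2 * f3 a b j * f1 j + 2 * f2 a j * f2 b j) -
      ∑ j, ∑ k, G2 a b j k * (f2 j k + f1 j * f1 k) = f2 a b) (a b : ι) :
    ∑ j, (H2 j j a b - ∑ c, (C1 j c j a * f2 c b + C1 j c j b * f2 a c)) +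
      2 * (∑ j, ∑ l, (C1 a b j l - C1 j b a l) * f2 j l) -
      (∑ p, (∑ j, (C1 a p j j - C1 j p a j)) * f2 p b) -
      (∑ p, (∑ j, (C1 b p j j - C1 j p b j)) * f2 a p) +
      ∑ k, (f1 k * H1 k a b + f2 k b * f2 a k + f2 a k * f2 b k) - f2 a b = 0 := by
  -- An identity valid for arbitrary jets with the stated symmetries: `(Δ_L + ℒ_∇f) D²f` equals the
  -- second derivative of `Δf + |∇f|²` plus the contraction with `∇f` of the Koszul-type combination
  -- of the defects in the differentiated soliton equation. The hypotheses `hric` and `hN` enter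
  -- only afterwards.
  have key : ∑ j, (H2 j j a b - ∑ c, (C1 j c j a * f2 c b + C1 j c j b * f2 a c)) +
      2 * (∑ j, ∑ l, (C1 a b j l - C1 j b a l) * f2 j l) -
      (∑ p, (∑ j, (C1 a p j j - C1 j p a j)) * f2 p b) -
      (∑ p, (∑ j, (C1 b p j j - C1 j p b j)) * f2 a p) +
      ∑ k, (f1 k * H1 k a b + f2 k b * f2 a k + f2 a k * f2 b k) -
      (∑ j, (H2 a b j j + 2 * f3 a b j * f1 j + 2 * f2 a j * f2 b j) -
        ∑ j, ∑ k, G2 a b j k * (f2 j k + f1 j * f1 k)) -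
      ∑ l, f1 l * ((∑ j, (C2 a b l j j - C2 a j l b j) - H1 a b l) +
        (∑ j, (C2 b a l j j - C2 b j l a j) - H1 b a l) -
        (∑ j, (C2 l a b j j - C2 l j b a j) - H1 l a b)) = 0 := by
    have e1 : (∑ p, (∑ j, (C1 a p j j - C1 j p a j)) * f2 p b) =
        ∑ j, ∑ p, (C1 a p j j - C1 j p a j) * f2 p b := by
      rw [Finset.sum_comm]; simp only [Finset.sum_mul]
    have e2 : (∑ p, (∑ j, (C1 b p j j - C1 j p b j)) * f2 a p) =
        ∑ j, ∑ p, (C1 b p j j - C1 j p b j) * f2 a p := by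
      rw [Finset.sum_comm]; simp only [Finset.sum_mul]
    have e3 : ∑ l, f1 l * ((∑ j, (C2 a b l j j - C2 a j l b j) - H1 a b l) +
        (∑ j, (C2 b a l j j - C2 b j l a j) - H1 b a l) -
        (∑ j, (C2 l a b j j - C2 l j b a j) - H1 l a b)) =
        (∑ j, ∑ l, f1 l * ((C2 a b l j j - C2 a j l b j) + (C2 b a l j j - C2 b j l a j) -
          (C2 l a b j j - C2 l j b a j))) - ∑ j, f1 j * (H1 a b j + H1 b a j - H1 j a b) := by
      rw [Finset.sum_comm, ← Finset.sum_sub_distrib]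
      refine Finset.sum_congr rfl fun l _ => ?_
      rw [← Finset.mul_sum, ← mul_sub]
      simp only [Finset.sum_sub_distrib, Finset.sum_add_distrib]
      ring
    rw [e1, e2, e3]
    have e4 : ∀ T : ι → ι → ℝ, (∑ j, ∑ c, (T j c - T c j)) = 0 := fun T => by
      simp only [Finset.sum_sub_distrib]
      rw [Finset.sum_comm (f := fun j c => T c j), sub_self]
    -- The double sums agree only after exchanging the two summation indices in some terms. Adding
    -- this antisymmetric sum, which is zero, makes the remaining identity hold for each pair `(j,
    -- c)` separately.
    rw [← e4 fun j c => G2 a c j b * f2 j c + f1 j * f1 c * ((G2 a j b c + G2 b j a c) / -2)]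
    simp only [hH1, hH2, Finset.mul_sum, mul_add, mul_sub, ← Finset.sum_add_distrib,
      ← Finset.sum_sub_distrib]
    refine Finset.sum_congr rfl fun j _ => ?_
    have hz : ∑ c, (-(C2 j j c a b * f1 c + C1 j c a b * f2 j c + C1 j c a b * f2 j c) -
        (C1 j c j a * f2 c b + C1 j c j b * f2 a c) + 2 * ((C1 a b j c - C1 j b a c) * f2 j c) -
        (C1 a c j j - C1 j c a j) * f2 c b - (C1 b c j j - C1 j c b j) * f2 a c -
        f1 j * (C1 j c a b * f1 c) +
        (C2 a b c j j * f1 c + C1 a c j j * f2 b c + C1 b c j j * f2 a c) +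
        (G2 a b j c * f2 j c + G2 a b j c * (f1 j * f1 c)) -
        (f1 c * C2 a b c j j - f1 c * C2 a j c b j + (f1 c * C2 b a c j j - f1 c * C2 b j c a j) -
          (f1 c * C2 c a b j j - f1 c * C2 c j b a j)) -
        f1 j * (C1 a c b j * f1 c) - f1 j * (C1 b c a j * f1 c) + f1 j * (C1 j c a b * f1 c) -
        (G2 a c j b * f2 j c + f1 j * f1 c * ((G2 a j b c + G2 b j a c) / -2) -
          (G2 a j c b * f2 c j + f1 c * f1 j * ((G2 a c b j + G2 b c a j) / -2)))) = 0 := by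
      refine Finset.sum_eq_zero fun c _ => ?_
      simp only [hC1, hC2, hG2 j a, hG2 j b, hG2 b a, fun i k => hG2' i k j a,
        fun i k => hG2' i k j b, fun i k => hG2' i k c b, hG3 j a, hG3 j b, hG3 c a, hG3 c j,
        hG3 b a, fun i => hG3' i j a, fun i => hG3' i j b, fun i => hG3' i c a,
        fun i => hG3' i c b, fun i => hG3' i c j, fun i k l => hG3'' i k l j b, hf2 c j, hf2 c b]
      ring
    simp only [Finset.sum_add_distrib, Finset.sum_sub_distrib, Finset.sum_neg_distrib] at hz ⊢
    -- The fourth derivatives cancel because those of `Δ(D²f)` and `D²(Δf)` differ only in the order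
    -- of differentiation.
    rw [hf4 j j a b, hf3 b a j, hf3 j a b, hf3' a j b, hf2 j b]
    linear_combination hz
  rw [hN] at key
  simp only [hric, sub_self, add_zero, mul_zero, Finset.sum_const_zero, sub_zero] at key
  exact key

end

section

variable {n : ℕ}

/-! ### Calculus of partial derivatives -/

theorem pd_congr {u v : Euc n → ℝ} {x : Euc n} (h : u =ᶠ[𝓝 x] v) (i : Fin n) :
    pd i u x = pd i v x := by
  simp only [pd, h.fderiv_eq]

theorem pd_eventuallyEq {u v : Euc n → ℝ} {x : Euc n} (h : u =ᶠ[𝓝 x] v) (i : Fin n) :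
    pd i u =ᶠ[𝓝 x] pd i v := by
  filter_upwards [h.eventuallyEq_nhds] with y hy using pd_congr hy i

theorem pd_add {u v : Euc n → ℝ} {x : Euc n} (hu : DifferentiableAt ℝ u x)
    (hv : DifferentiableAt ℝ v x) (i : Fin n) :
    pd i (fun y => u y + v y) x = pd i u x + pd i v x := by
  simp [pd, fderiv_fun_add hu hv]

theorem pd_sub {u v : Euc n → ℝ} {x : Euc n} (hu : DifferentiableAt ℝ u x)
    (hv : DifferentiableAt ℝ v x) (i : Fin n) :
    pd i (fun y => u y - v y) x = pd i u x - pd i v x := by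
  simp [pd, fderiv_fun_sub hu hv]

theorem pd_mul {u v : Euc n → ℝ} {x : Euc n} (hu : DifferentiableAt ℝ u x)
    (hv : DifferentiableAt ℝ v x) (i : Fin n) :
    pd i (fun y => u y * v y) x = pd i u x * v x + u x * pd i v x := by
  simp [pd, fderiv_fun_mul hu hv]; ring

theorem pd_const (c : ℝ) (i : Fin n) (x : Euc n) : pd i (fun _ => c) x = 0 := by
  simp [pd]

theorem pd_const_mul {u : Euc n → ℝ} {x : Euc n} (hu : DifferentiableAt ℝ u x) (c : ℝ)
    (i : Fin n) : pd i (fun y => c * u y) x = c * pd i u x := by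
  simp [pd, fderiv_const_mul hu]

theorem pd_sum {ι : Type*} (s : Finset ι) {u : ι → Euc n → ℝ} {x : Euc n}
    (hu : ∀ k ∈ s, DifferentiableAt ℝ (u k) x) (i : Fin n) :
    pd i (fun y => ∑ k ∈ s, u k y) x = ∑ k ∈ s, pd i (u k) x := by
  simp [pd, fderiv_fun_sum hu]

theorem contDiffOn_pd {U : Set (Euc n)} (hU : IsOpen U) {u : Euc n → ℝ} {k m : ℕ∞}
    (hu : ContDiffOn ℝ k u U) (hmk : m + 1 ≤ k) (i : Fin n) : ContDiffOn ℝ m (pd i u) U :=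
  ((hu.fderiv_of_isOpen hU (by exact_mod_cast hmk)).clm_apply contDiffOn_const)

theorem contDiffAt_pd {u : Euc n → ℝ} {x : Euc n} {k m : ℕ∞}
    (hu : ContDiffAt ℝ k u x) (hmk : m + 1 ≤ k) (i : Fin n) : ContDiffAt ℝ m (pd i u) x :=
  ((hu.fderiv_right (by exact_mod_cast hmk)).clm_apply contDiffAt_const)

theorem differentiableAt_pd {u : Euc n → ℝ} {x : Euc n} (hu : ContDiffAt ℝ 2 u x) (i : Fin n) :
    DifferentiableAt ℝ (pd i u) x :=
  (contDiffAt_pd (k := 2) (m := 1) hu (by norm_num) i).differentiableAt (by norm_num)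

theorem pd_comm {u : Euc n → ℝ} {x : Euc n} (hu : ContDiffAt ℝ 2 u x) (i j : Fin n) :
    pd i (pd j u) x = pd j (pd i u) x := by
  have hd : DifferentiableAt ℝ (fderiv ℝ u) x :=
    (hu.fderiv_right (m := 1) (by norm_num)).differentiableAt (by norm_num)
  have h (a b : Fin n) : pd a (pd b u) x =
      fderiv ℝ (fderiv ℝ u) x (EuclideanSpace.single a 1) (EuclideanSpace.single b 1) := by
    have : pd b u = fun y => fderiv ℝ u y (EuclideanSpace.single b 1) := rfl
    rw [this, pd, fderiv_clm_apply hd (differentiableAt_const _)]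
    simp
  rw [h, h]
  exact (hu.isSymmSndFDerivAt (by simp)) _ _

theorem eventually_differentiableAt {u : Euc n → ℝ} {x : Euc n} (hu : ContDiffAt ℝ 2 u x) :
    ∀ᶠ y in 𝓝 x, DifferentiableAt ℝ u y := by
  filter_upwards [hu.eventually (by norm_num)] with y hy using hy.differentiableAt (by norm_num)

theorem pd_pd_add {u v : Euc n → ℝ} {x : Euc n} (hu : ContDiffAt ℝ 2 u x)
    (hv : ContDiffAt ℝ 2 v x) (i j : Fin n) :
    pd i (pd j (fun y => u y + v y)) x = pd i (pd j u) x + pd i (pd j v) x := by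
  rw [← pd_add (differentiableAt_pd hu j) (differentiableAt_pd hv j)]
  refine pd_congr ?_ i
  filter_upwards [eventually_differentiableAt hu, eventually_differentiableAt hv] with y h1 h2
    using pd_add h1 h2 j

theorem pd_pd_sub {u v : Euc n → ℝ} {x : Euc n} (hu : ContDiffAt ℝ 2 u x)
    (hv : ContDiffAt ℝ 2 v x) (i j : Fin n) :
    pd i (pd j (fun y => u y - v y)) x = pd i (pd j u) x - pd i (pd j v) x := by
  rw [← pd_sub (differentiableAt_pd hu j) (differentiableAt_pd hv j)]
  refine pd_congr ?_ i
  filter_upwards [eventually_differentiableAt hu, eventually_differentiableAt hv] with y h1 h2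
    using pd_sub h1 h2 j

theorem pd_pd_mul {u v : Euc n → ℝ} {x : Euc n} (hu : ContDiffAt ℝ 2 u x)
    (hv : ContDiffAt ℝ 2 v x) (i j : Fin n) :
    pd i (pd j (fun y => u y * v y)) x = pd i (pd j u) x * v x + pd j u x * pd i v x +
      pd i u x * pd j v x + u x * pd i (pd j v) x := by
  have h1 := hu.differentiableAt (by norm_num)
  have h2 := hv.differentiableAt (by norm_num)
  have : pd j (fun y => u y * v y) =ᶠ[𝓝 x] fun y => pd j u y * v y + u y * pd j v y := by
    filter_upwards [eventually_differentiableAt hu, eventually_differentiableAt hv] with y h1 h2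
      using pd_mul h1 h2 j
  rw [pd_congr this, pd_add ((differentiableAt_pd hu j).fun_mul h2)
    (h1.fun_mul (differentiableAt_pd hv j)),
    pd_mul (differentiableAt_pd hu j) h2, pd_mul h1 (differentiableAt_pd hv j)]
  ring

theorem pd_pd_const_mul {u : Euc n → ℝ} {x : Euc n} (hu : ContDiffAt ℝ 2 u x) (c : ℝ)
    (i j : Fin n) : pd i (pd j (fun y => c * u y)) x = c * pd i (pd j u) x := by
  rw [← pd_const_mul (differentiableAt_pd hu j)]
  refine pd_congr ?_ i
  filter_upwards [eventually_differentiableAt hu] with y h1 using pd_const_mul h1 c j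

theorem pd_pd_sum {ι : Type*} (s : Finset ι) {u : ι → Euc n → ℝ} {x : Euc n}
    (hu : ∀ k ∈ s, ContDiffAt ℝ 2 (u k) x) (i j : Fin n) :
    pd i (pd j (fun y => ∑ k ∈ s, u k y)) x = ∑ k ∈ s, pd i (pd j (u k)) x := by
  rw [← pd_sum s fun k hk => differentiableAt_pd (hu k hk) j]
  refine pd_congr ?_ i
  have : ∀ᶠ y in 𝓝 x, ∀ k ∈ s, DifferentiableAt ℝ (u k) y :=
    (Finset.eventually_all s).2 fun k hk => eventually_differentiableAt (hu k hk)
  filter_upwards [this] with y hy using pd_sum s hy j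

/-! ### Metrics on open subsets of coordinate space -/

/-- `G` is the matrix of a smooth Riemannian metric on the open set `U`. -/
structure IsMetricOn (G : Euc n → Matrix (Fin n) (Fin n) ℝ) (U : Set (Euc n)) : Prop where
  isOpen : IsOpen U
  smooth : ∀ a b, ContDiffOn ℝ ∞ (fun y => G y a b) U
  posDef : ∀ y ∈ U, (G y).PosDef

/-- The coordinates are normal (to first order) for `G` at `x`. -/
structure IsNormalAt (G : Euc n → Matrix (Fin n) (Fin n) ℝ) (x : Euc n) : Prop where
  eq_one : G x = 1
  pd_eq_zero : ∀ i a b, pd i (fun y => G y a b) x = 0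

section

variable {G : Euc n → Matrix (Fin n) (Fin n) ℝ} {U : Set (Euc n)} {x : Euc n}

theorem IsMetricOn.symm (hG : IsMetricOn G U) (hx : x ∈ U) (a b : Fin n) : G x a b = G x b a := by
  simpa using (hG.posDef x hx).isHermitian.apply b a

theorem IsMetricOn.isUnit_det (hG : IsMetricOn G U) (hx : x ∈ U) : IsUnit (G x).det :=
  (hG.posDef x hx).det_pos.ne'.isUnit

theorem IsMetricOn.smooth_inv (hG : IsMetricOn G U) (a b : Fin n) :
    ContDiffOn ℝ ∞ (fun y => (G y)⁻¹ a b) U := by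
  have hdet (A : Euc n → Matrix (Fin n) (Fin n) ℝ) (hA : ∀ a b, ContDiffOn ℝ ∞ (fun y => A y a b) U) :
      ContDiffOn ℝ ∞ (fun y => (A y).det) U := by
    simp only [Matrix.det_apply]
    exact ContDiffOn.sum fun σ _ => (contDiffOn_prod fun i _ => hA _ _).const_smul _
  simp only [Matrix.inv_def, Matrix.smul_apply, Matrix.adjugate_apply, smul_eq_mul,
    Ring.inverse_eq_inv']
  refine ((hdet G hG.smooth).inv fun y hy => (hG.isUnit_det hy).ne_zero).mul (hdet _ fun c d => ?_)
  by_cases h : c = b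
  · subst h; simp only [Matrix.updateRow_self]; exact contDiffOn_const
  · simpa only [Matrix.updateRow_ne h] using hG.smooth c d

theorem IsMetricOn.inv_mul (hG : IsMetricOn G U) (hx : x ∈ U) (a b : Fin n) :
    ∑ c, (G x)⁻¹ a c * G x c b = if a = b then 1 else 0 := by
  have := congr_fun₂ (Matrix.nonsing_inv_mul (G x) (hG.isUnit_det hx)) a b
  simpa [Matrix.mul_apply, Matrix.one_apply] using this

theorem IsMetricOn.mul_inv (hG : IsMetricOn G U) (hx : x ∈ U) (a b : Fin n) :
    ∑ c, G x a c * (G x)⁻¹ c b = if a = b then 1 else 0 := by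
  have := congr_fun₂ (Matrix.mul_nonsing_inv (G x) (hG.isUnit_det hx)) a b
  simpa [Matrix.mul_apply, Matrix.one_apply] using this

theorem _root_.ContDiffOn.contDiffAt_two {u : Euc n → ℝ} (hu : ContDiffOn ℝ ∞ u U) (hU : IsOpen U)
    (hx : x ∈ U) : ContDiffAt ℝ 2 u x :=
  (hu.contDiffAt (hU.mem_nhds hx)).of_le ENat.LEInfty.out

theorem _root_.ContDiffOn.differentiableAt_of_isOpen {u : Euc n → ℝ} (hu : ContDiffOn ℝ ∞ u U)
    (hU : IsOpen U) (hx : x ∈ U) : DifferentiableAt ℝ u x :=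
  (hu.contDiffAt (hU.mem_nhds hx)).differentiableAt (by simp)

theorem IsMetricOn.smooth_pd (hG : IsMetricOn G U) (i a b : Fin n) :
    ContDiffOn ℝ ∞ (pd i (fun y => G y a b)) U :=
  contDiffOn_pd hG.isOpen (k := ⊤) (m := ⊤) (hG.smooth a b) le_rfl i

theorem IsMetricOn.smooth_christoffel (hG : IsMetricOn G U) (k i j : Fin n) :
    ContDiffOn ℝ ∞ (christoffel G k i j) U := by
  unfold christoffel
  exact contDiffOn_const.mul (ContDiffOn.sum fun l _ => (hG.smooth_inv k l).mul
    (((hG.smooth_pd i j l).add (hG.smooth_pd j i l)).sub (hG.smooth_pd l i j)))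

theorem IsMetricOn.smooth_pd_christoffel (hG : IsMetricOn G U) (a k i j : Fin n) :
    ContDiffOn ℝ ∞ (pd a (christoffel G k i j)) U :=
  contDiffOn_pd hG.isOpen (k := ⊤) (m := ⊤) (hG.smooth_christoffel k i j) le_rfl a

theorem IsMetricOn.smooth_riemann (hG : IsMetricOn G U) (i j k l : Fin n) :
    ContDiffOn ℝ ∞ (riemann G i j k l) U := by
  unfold riemann
  exact ContDiffOn.sum fun m _ => (hG.smooth k m).mul
    (((hG.smooth_pd_christoffel i m j l).sub (hG.smooth_pd_christoffel j m i l)).add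
      (ContDiffOn.sum fun p _ =>
        ((hG.smooth_christoffel p j l).mul (hG.smooth_christoffel m i p)).sub
          ((hG.smooth_christoffel p i l).mul (hG.smooth_christoffel m j p))))

/-- Christoffel symbols of the first kind. -/
theorem IsMetricOn.sum_mul_christoffel (hG : IsMetricOn G U) (hx : x ∈ U) (k i j : Fin n) :
    ∑ m, G x k m * christoffel G m i j x = (1 / 2) * (pd i (fun y => G y j k) x +
      pd j (fun y => G y i k) x - pd k (fun y => G y i j) x) := by
  unfold christoffel
  have : ∀ m, G x k m * ((1 / 2) * ∑ l, (G x)⁻¹ m l *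
      (pd i (fun y => G y j l) x + pd j (fun y => G y i l) x - pd l (fun y => G y i j) x)) =
      ∑ l, (1 / 2) * ((G x k m * (G x)⁻¹ m l) *
      (pd i (fun y => G y j l) x + pd j (fun y => G y i l) x - pd l (fun y => G y i j) x)) := by
    intro m; simp only [Finset.mul_sum]; exact Finset.sum_congr rfl fun l _ => by ring
  simp only [this]
  rw [Finset.sum_comm]
  simp only [← Finset.mul_sum, ← Finset.sum_mul, hG.mul_inv hx]
  simp

/-! ### The Hessian -/

/-- Components of the Hessian `D²u`. -/
def hess (G : Euc n → Matrix (Fin n) (Fin n) ℝ) (u : Euc n → ℝ) (x : Euc n) :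
    Matrix (Fin n) (Fin n) ℝ :=
  Matrix.of fun a b => pd a (pd b u) x - ∑ c, christoffel G c a b x * pd c u x

theorem IsMetricOn.smooth_hess (hG : IsMetricOn G U) {u : Euc n → ℝ} (hu : ContDiffOn ℝ ∞ u U)
    (a b : Fin n) : ContDiffOn ℝ ∞ (fun y => hess G u y a b) U := by
  have h1 (c : Fin n) : ContDiffOn ℝ ∞ (pd c u) U :=
    contDiffOn_pd hG.isOpen (k := ⊤) (m := ⊤) hu le_rfl c
  have h2 : ContDiffOn ℝ ∞ (pd a (pd b u)) U :=
    contDiffOn_pd hG.isOpen (k := ⊤) (m := ⊤) (h1 b) le_rfl a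
  exact h2.sub (ContDiffOn.sum fun c _ => (hG.smooth_christoffel c a b).mul (h1 c))

theorem IsMetricOn.smooth_grad (hG : IsMetricOn G U) {u : Euc n → ℝ} (hu : ContDiffOn ℝ ∞ u U)
    (i : Fin n) : ContDiffOn ℝ ∞ (grad G u i) U :=
  ContDiffOn.sum fun j _ => (hG.smooth_inv i j).mul
    (contDiffOn_pd hG.isOpen (k := ⊤) (m := ⊤) hu le_rfl j)

theorem IsMetricOn.sum_mul_grad (hG : IsMetricOn G U) (hx : x ∈ U) (u : Euc n → ℝ) (j : Fin n) :
    ∑ k, G x k j * grad G u k x = pd j u x := by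
  unfold grad
  simp only [Finset.mul_sum, ← mul_assoc]
  rw [Finset.sum_comm]
  simp only [← Finset.sum_mul, fun k => hG.symm hx k j, hG.mul_inv hx]
  simp

/-- Differentiating `g_kj X^k = ∂_j u` replaces `g_kj ∂_i X^k` by a second derivative of `u` and a
first derivative of `g`, so the inverse metric never has to be differentiated. -/
theorem IsMetricOn.lieDeriv_grad_eq (hG : IsMetricOn G U) {u : Euc n → ℝ}
    (hu : ContDiffOn ℝ ∞ u U) (hx : x ∈ U) (i j : Fin n) :
    lieDeriv (grad G u) G i j x = 2 * pd i (pd j u) x - ∑ k, grad G u k x *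
      (pd i (fun y => G y k j) x + pd j (fun y => G y i k) x - pd k (fun y => G y i j) x) := by
  have h2 (i j : Fin n) : ∑ k, (pd i (fun y => G y k j) x * grad G u k x +
      G x k j * pd i (grad G u k) x) = pd i (pd j u) x := by
    have e : pd j u =ᶠ[𝓝 x] fun y => ∑ k, G y k j * grad G u k y := by
      filter_upwards [hG.isOpen.mem_nhds hx] with y hy using (hG.sum_mul_grad hy u j).symm
    rw [pd_congr e, pd_sum]
    · refine Finset.sum_congr rfl fun k _ => ?_
      rw [pd_mul ((hG.smooth k j).differentiableAt_of_isOpen hG.isOpen hx)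
        ((hG.smooth_grad hu k).differentiableAt_of_isOpen hG.isOpen hx)]
    · exact fun k _ => ((hG.smooth k j).differentiableAt_of_isOpen hG.isOpen hx).mul
        ((hG.smooth_grad hu k).differentiableAt_of_isOpen hG.isOpen hx)
  have h3 : ∑ k, (pd j (fun y => G y i k) x * grad G u k x +
      G x i k * pd j (grad G u k) x) = pd i (pd j u) x := by
    rw [pd_comm (hu.contDiffAt_two hG.isOpen hx), ← h2 j i]
    refine Finset.sum_congr rfl fun k _ => ?_
    have : (fun y => G y i k) =ᶠ[𝓝 x] fun y => G y k i := by
      filter_upwards [hG.isOpen.mem_nhds hx] with y hy using hG.symm hy i k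
    rw [pd_congr this, hG.symm hx i k]
  have h4 := h2 i j
  unfold lieDeriv
  simp only [Finset.sum_add_distrib, mul_add, mul_sub, Finset.sum_sub_distrib] at *
  simp only [mul_comm (grad G u _ x)] at *
  linarith

/-- Writing `∂_c u = g_kc X^k` lowers the upper index of the Christoffel symbol. This is the same
sum as in `lieDeriv_grad_eq`, so the two together give `ℒ_∇u g = 2 D²u`. -/
theorem IsMetricOn.sum_christoffel_mul_pd (hG : IsMetricOn G U) (hx : x ∈ U) (u : Euc n → ℝ)
    (i j : Fin n) : 2 * ∑ c, christoffel G c i j x * pd c u x = ∑ k, grad G u k x *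
      (pd i (fun y => G y k j) x + pd j (fun y => G y i k) x - pd k (fun y => G y i j) x) := by
  simp only [← hG.sum_mul_grad hx u, Finset.mul_sum]
  rw [Finset.sum_comm]
  refine Finset.sum_congr rfl fun k _ => ?_
  have : (fun y => G y k j) =ᶠ[𝓝 x] fun y => G y j k := by
    filter_upwards [hG.isOpen.mem_nhds hx] with y hy using hG.symm hy k j
  rw [pd_congr this]
  have := hG.sum_mul_christoffel hx k i j
  linear_combination (exp := 1) (2 * grad G u k x) * this +
    (by rw [Finset.mul_sum]; exact Finset.sum_congr rfl fun m _ => by ring :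
      ∑ c, 2 * (christoffel G c i j x * (G x k c * grad G u k x)) =
        2 * grad G u k x * ∑ m, G x k m * christoffel G m i j x)

theorem IsMetricOn.lieDeriv_grad_eq_hess (hG : IsMetricOn G U) {u : Euc n → ℝ}
    (hu : ContDiffOn ℝ ∞ u U) (hx : x ∈ U) (i j : Fin n) :
    lieDeriv (grad G u) G i j x = 2 * hess G u x i j := by
  rw [hG.lieDeriv_grad_eq hu hx, ← hG.sum_christoffel_mul_pd hx, hess, Matrix.of_apply]
  ring

end

end

section

variable {n : ℕ}

section

variable {G : Euc n → Matrix (Fin n) (Fin n) ℝ} {U : Set (Euc n)} {x : Euc n}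

/-! ### Jets at the centre of normal coordinates -/

theorem IsNormalAt.apply (hN : IsNormalAt G x) (a b : Fin n) :
    G x a b = if a = b then 1 else 0 := by
  rw [hN.eq_one, Matrix.one_apply]

theorem IsNormalAt.inv_apply (hN : IsNormalAt G x) (a b : Fin n) :
    (G x)⁻¹ a b = if a = b then 1 else 0 := by
  rw [hN.eq_one, inv_one, Matrix.one_apply]

theorem IsMetricOn.sum_inv_mul_eventuallyEq (hG : IsMetricOn G U) (hx : x ∈ U) (a b : Fin n) :
    (fun y => ∑ c, (G y)⁻¹ a c * G y c b) =ᶠ[𝓝 x] fun _ => if a = b then 1 else 0 := by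
  filter_upwards [hG.isOpen.mem_nhds hx] with y hy using hG.inv_mul hy a b

theorem IsMetricOn.pd_inv (hG : IsMetricOn G U) (hx : x ∈ U) (hN : IsNormalAt G x)
    (i a b : Fin n) : pd i (fun y => (G y)⁻¹ a b) x = 0 := by
  have d1 (c d : Fin n) := (hG.smooth c d).differentiableAt_of_isOpen hG.isOpen hx
  have d2 (c d : Fin n) := (hG.smooth_inv c d).differentiableAt_of_isOpen hG.isOpen hx
  have := pd_congr (hG.sum_inv_mul_eventuallyEq hx a b) i
  rw [pd_const, pd_sum _ fun c _ => (d2 a c).fun_mul (d1 c b)] at this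
  simpa [pd_mul (d2 a _) (d1 _ b), hN.pd_eq_zero, hN.apply] using this

/-- Differentiate `g⁻¹ g = 1` twice; the mixed terms contain first derivatives, which vanish at the
centre. -/
theorem IsMetricOn.pd_pd_inv (hG : IsMetricOn G U) (hx : x ∈ U) (hN : IsNormalAt G x)
    (i j a b : Fin n) : pd i (pd j (fun y => (G y)⁻¹ a b)) x = -pd i (pd j (fun y => G y a b)) x := by
  have d1 (c d : Fin n) := (hG.smooth c d).contDiffAt_two hG.isOpen hx
  have d2 (c d : Fin n) := (hG.smooth_inv c d).contDiffAt_two hG.isOpen hx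
  have := pd_congr (pd_eventuallyEq (hG.sum_inv_mul_eventuallyEq hx a b) j) i
  have e : pd j (fun _ : Euc n => if a = b then (1 : ℝ) else 0) = fun _ => 0 :=
    funext fun y => pd_const _ _ _
  rw [e, pd_const, pd_pd_sum _ fun c _ => (d2 a c).mul (d1 c b)] at this
  simp only [pd_pd_mul (d2 a _) (d1 _ b), hN.pd_eq_zero, hG.pd_inv hx hN, hN.apply,
    hN.inv_apply, Finset.sum_add_distrib] at this
  simp at this
  linarith

theorem IsNormalAt.christoffel_eq_zero (hN : IsNormalAt G x) (k i j : Fin n) :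
    christoffel G k i j x = 0 := by
  simp [christoffel, hN.pd_eq_zero]

theorem IsMetricOn.pd_christoffel (hG : IsMetricOn G U) (hx : x ∈ U) (hN : IsNormalAt G x)
    (a k i j : Fin n) : pd a (christoffel G k i j) x = (1 / 2) *
      (pd a (pd i (fun y => G y j k)) x + pd a (pd j (fun y => G y i k)) x -
        pd a (pd k (fun y => G y i j)) x) := by
  have d1 (i c d : Fin n) := (hG.smooth_pd i c d).differentiableAt_of_isOpen hG.isOpen hx
  have d2 (c d : Fin n) := (hG.smooth_inv c d).differentiableAt_of_isOpen hG.isOpen hx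
  have d3 (l : Fin n) := ((d1 i j l).fun_add (d1 j i l)).fun_sub (d1 l i j)
  unfold christoffel
  rw [pd_const_mul (DifferentiableAt.fun_sum fun l _ => (d2 k l).fun_mul (d3 l)),
    pd_sum _ fun l _ => (d2 k l).fun_mul (d3 l)]
  simp only [pd_mul (d2 k _) (d3 _), hG.pd_inv hx hN, hN.inv_apply]
  simp [pd_sub ((d1 i j k).fun_add (d1 j i k)) (d1 k i j), pd_add (d1 i j k) (d1 j i k)]

/-- Second derivatives of `g⁻¹` do not vanish at the centre, but they multiply first derivatives of
`g`, which do. Hence only the third derivatives of `g` survive. -/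
theorem IsMetricOn.pd_pd_christoffel (hG : IsMetricOn G U) (hx : x ∈ U) (hN : IsNormalAt G x)
    (a b k i j : Fin n) : pd a (pd b (christoffel G k i j)) x = (1 / 2) *
      (pd a (pd b (pd i (fun y => G y j k))) x + pd a (pd b (pd j (fun y => G y i k))) x -
        pd a (pd b (pd k (fun y => G y i j))) x) := by
  have d1 (i c d : Fin n) := (hG.smooth_pd i c d).contDiffAt_two hG.isOpen hx
  have d2 (c d : Fin n) := (hG.smooth_inv c d).contDiffAt_two hG.isOpen hx
  have d3 (l : Fin n) := ((d1 i j l).add (d1 j i l)).sub (d1 l i j)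
  unfold christoffel
  rw [pd_pd_const_mul (ContDiffAt.sum fun l _ => (d2 k l).mul (d3 l)),
    pd_pd_sum _ fun l _ => (d2 k l).mul (d3 l)]
  simp only [pd_pd_mul (d2 k _) (d3 _), hG.pd_inv hx hN, hN.inv_apply, hN.pd_eq_zero]
  simp [pd_pd_sub ((d1 i j k).add (d1 j i k)) (d1 k i j), pd_pd_add (d1 i j k) (d1 j i k)]

theorem IsNormalAt.riemann_eq (hN : IsNormalAt G x) (i j k l : Fin n) :
    riemann G i j k l x = pd i (christoffel G k j l) x - pd j (christoffel G k i l) x := by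
  simp [riemann, IsNormalAt.christoffel_eq_zero hN, hN.apply]

/-- The part of the curvature quadratic in the Christoffel symbols vanishes to second order at the
centre and so does not contribute to a first derivative. -/
theorem IsMetricOn.pd_riemann (hG : IsMetricOn G U) (hx : x ∈ U) (hN : IsNormalAt G x)
    (a i j k l : Fin n) : pd a (riemann G i j k l) x =
      pd a (pd i (christoffel G k j l)) x - pd a (pd j (christoffel G k i l)) x := by
  have d0 (c d : Fin n) := (hG.smooth c d).differentiableAt_of_isOpen hG.isOpen hx
  have d1 (c i j : Fin n) := (hG.smooth_christoffel c i j).differentiableAt_of_isOpen hG.isOpen hx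
  have d2 (i c d e : Fin n) :=
    (hG.smooth_pd_christoffel i c d e).differentiableAt_of_isOpen hG.isOpen hx
  have d3 (m p : Fin n) := ((d1 p j l).fun_mul (d1 m i p)).fun_sub ((d1 p i l).fun_mul (d1 m j p))
  have d4 (m : Fin n) := ((d2 i m j l).fun_sub (d2 j m i l)).fun_add
    (DifferentiableAt.fun_sum (u := Finset.univ) fun p _ => d3 m p)
  have e (m : Fin n) := pd_add ((d2 i m j l).fun_sub (d2 j m i l))
    (DifferentiableAt.fun_sum (u := Finset.univ) fun p _ => d3 m p) a
  unfold riemann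
  rw [pd_sum _ fun m _ => (d0 k m).fun_mul (d4 m)]
  simp only [pd_mul (d0 k _) (d4 _), hN.pd_eq_zero, hN.apply, e, pd_sum _ fun p _ => d3 _ p,
    pd_sub (d2 i _ j l) (d2 j _ i l),
    pd_sub ((d1 _ j l).fun_mul (d1 _ i _)) ((d1 _ i l).fun_mul (d1 _ j _)),
    pd_mul (d1 _ j l) (d1 _ i _), pd_mul (d1 _ i l) (d1 _ j _),
    IsNormalAt.christoffel_eq_zero hN]
  simp

theorem IsNormalAt.ricci_eq (hN : IsNormalAt G x) (i k : Fin n) :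
    ricci G i k x = ∑ j, riemann G i j k j x := by
  simp [ricci, hN.inv_apply]

theorem IsMetricOn.pd_ricci (hG : IsMetricOn G U) (hx : x ∈ U) (hN : IsNormalAt G x)
    (a i k : Fin n) : pd a (ricci G i k) x = ∑ j, pd a (riemann G i j k j) x := by
  have d1 (c d : Fin n) := (hG.smooth_inv c d).differentiableAt_of_isOpen hG.isOpen hx
  have d2 (i j k l : Fin n) := (hG.smooth_riemann i j k l).differentiableAt_of_isOpen hG.isOpen hx
  unfold ricci
  rw [pd_sum _ fun j _ => DifferentiableAt.fun_sum fun l _ => (d1 j l).fun_mul (d2 i j k l)]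
  simp only [pd_sum _ fun l _ => (d1 _ l).fun_mul (d2 i _ k l), pd_mul (d1 _ _) (d2 i _ k _),
    hG.pd_inv hx hN, hN.inv_apply]
  simp

theorem IsNormalAt.hess_eq (hN : IsNormalAt G x) (u : Euc n → ℝ) (a b : Fin n) :
    hess G u x a b = pd a (pd b u) x := by
  simp [hess, IsNormalAt.christoffel_eq_zero hN]

theorem IsMetricOn.pd_hess (hG : IsMetricOn G U) (hx : x ∈ U) (hN : IsNormalAt G x)
    {u : Euc n → ℝ} (hu : ContDiffOn ℝ ∞ u U) (i a b : Fin n) :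
    pd i (fun y => hess G u y a b) x =
      pd i (pd a (pd b u)) x - ∑ c, pd i (christoffel G c a b) x * pd c u x := by
  have h1 (c : Fin n) : ContDiffOn ℝ ∞ (pd c u) U :=
    contDiffOn_pd hG.isOpen (k := ⊤) (m := ⊤) hu le_rfl c
  have h2 : ContDiffOn ℝ ∞ (pd a (pd b u)) U :=
    contDiffOn_pd hG.isOpen (k := ⊤) (m := ⊤) (h1 b) le_rfl a
  have d1 (c : Fin n) := (h1 c).differentiableAt_of_isOpen hG.isOpen hx
  have d2 := h2.differentiableAt_of_isOpen hG.isOpen hx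
  have d3 (c : Fin n) := (hG.smooth_christoffel c a b).differentiableAt_of_isOpen hG.isOpen hx
  unfold hess
  simp only [Matrix.of_apply]
  rw [pd_sub d2 (DifferentiableAt.fun_sum fun c _ => (d3 c).fun_mul (d1 c)),
    pd_sum _ fun c _ => (d3 c).fun_mul (d1 c)]
  simp [pd_mul (d3 _) (d1 _), IsNormalAt.christoffel_eq_zero hN]

theorem IsMetricOn.pd_pd_hess (hG : IsMetricOn G U) (hx : x ∈ U) (hN : IsNormalAt G x)
    {u : Euc n → ℝ} (hu : ContDiffOn ℝ ∞ u U) (i j a b : Fin n) :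
    pd i (pd j (fun y => hess G u y a b)) x = pd i (pd j (pd a (pd b u))) x -
      ∑ c, (pd i (pd j (christoffel G c a b)) x * pd c u x +
        pd i (christoffel G c a b) x * pd j (pd c u) x +
        pd j (christoffel G c a b) x * pd i (pd c u) x) := by
  have h1 (c : Fin n) : ContDiffOn ℝ ∞ (pd c u) U :=
    contDiffOn_pd hG.isOpen (k := ⊤) (m := ⊤) hu le_rfl c
  have h2 : ContDiffOn ℝ ∞ (pd a (pd b u)) U :=
    contDiffOn_pd hG.isOpen (k := ⊤) (m := ⊤) (h1 b) le_rfl a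
  have d1 (c : Fin n) := (h1 c).contDiffAt_two hG.isOpen hx
  have d2 := h2.contDiffAt_two hG.isOpen hx
  have d3 (c : Fin n) := (hG.smooth_christoffel c a b).contDiffAt_two hG.isOpen hx
  unfold hess
  simp only [Matrix.of_apply]
  rw [pd_pd_sub d2 (ContDiffAt.sum fun c _ => (d3 c).mul (d1 c)),
    pd_pd_sum _ fun c _ => (d3 c).mul (d1 c)]
  simp only [pd_pd_mul (d3 _) (d1 _), IsNormalAt.christoffel_eq_zero hN]
  congr 1
  exact Finset.sum_congr rfl fun c _ => by ring

theorem IsMetricOn.pd_grad (hG : IsMetricOn G U) (hx : x ∈ U) (hN : IsNormalAt G x)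
    {u : Euc n → ℝ} (hu : ContDiffOn ℝ ∞ u U) (i k : Fin n) :
    pd i (grad G u k) x = pd i (pd k u) x := by
  have d1 (c : Fin n) := (contDiffOn_pd hG.isOpen (k := ⊤) (m := ⊤) hu le_rfl c)
    |>.differentiableAt_of_isOpen hG.isOpen hx
  have d2 (c d : Fin n) := (hG.smooth_inv c d).differentiableAt_of_isOpen hG.isOpen hx
  unfold grad
  rw [pd_sum _ fun j _ => (d2 k j).fun_mul (d1 j)]
  simp [pd_mul (d2 k _) (d1 _), hG.pd_inv hx hN, hN.inv_apply]

theorem IsNormalAt.grad_eq (hN : IsNormalAt G x) (u : Euc n → ℝ) (k : Fin n) :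
    grad G u k x = pd k u x := by
  simp [grad, hN.inv_apply]

/-- The operator `Δ_L + ℒ_{∇u} - 1`. -/
def solitonOp (G : Euc n → Matrix (Fin n) (Fin n) ℝ) (u : Euc n → ℝ)
    (T : Euc n → Matrix (Fin n) (Fin n) ℝ) (a b : Fin n) (x : Euc n) : ℝ :=
  lichnerowicz G T a b x + lieDeriv (grad G u) T a b x - T x a b

/-- With vanishing Christoffel symbols, the outer covariant derivative is a partial derivative. The
inner one leaves the derivatives of the symbols, times undifferentiated components of `T`; that form
is what makes those terms disappear on a null vector. -/
theorem IsMetricOn.solitonOp_eq (hG : IsMetricOn G U) (hx : x ∈ U) (hN : IsNormalAt G x)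
    {u : Euc n → ℝ} (hu : ContDiffOn ℝ ∞ u U) {T : Euc n → Matrix (Fin n) (Fin n) ℝ}
    (hT : ∀ a b, ContDiffAt ℝ 2 (fun y => T y a b) x) (a b : Fin n) :
    solitonOp G u T a b x =
      ∑ j, (pd j (pd j (fun y => T y a b)) x - ∑ c, (pd j (christoffel G c j a) x * T x c b +
        pd j (christoffel G c j b) x * T x a c)) +
      2 * (∑ j, ∑ l, riemann G a j b l x * T x j l) -
      (∑ p, ricci G a p x * T x p b) - (∑ p, ricci G b p x * T x a p) +
      ∑ k, (pd k u x * pd k (fun y => T y a b) x + T x k b * pd a (pd k u) x +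
        T x a k * pd b (pd k u) x) - T x a b := by
  have d0 (c d : Fin n) := (hT c d).differentiableAt (by norm_num)
  have d1 (c i j : Fin n) := (hG.smooth_christoffel c i j).differentiableAt_of_isOpen hG.isOpen hx
  have d2 (j c d : Fin n) := differentiableAt_pd (hT c d) j
  have d3 (j c : Fin n) := ((d1 c j a).fun_mul (d0 c b)).fun_add ((d1 c j b).fun_mul (d0 a c))
  have e (j : Fin n) : pd j (covDeriv₂ G T j a b) x = pd j (pd j (fun y => T y a b)) x -
      ∑ c, (pd j (christoffel G c j a) x * T x c b + pd j (christoffel G c j b) x * T x a c) := by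
    unfold covDeriv₂
    rw [pd_sub (d2 j a b) (DifferentiableAt.fun_sum fun c _ => d3 j c), pd_sum _ fun c _ => d3 j c]
    simp [pd_add ((d1 _ j a).fun_mul (d0 _ b)) ((d1 _ j b).fun_mul (d0 a _)),
      pd_mul (d1 _ j a) (d0 _ b), pd_mul (d1 _ j b) (d0 a _), IsNormalAt.christoffel_eq_zero hN]
  simp only [solitonOp, lichnerowicz, roughLaplacian, covDeriv₂₂, lieDeriv, hN.inv_apply,
    hN.grad_eq, hG.pd_grad hx hN hu, IsNormalAt.christoffel_eq_zero hN]
  simp [e]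

/-! ### Soliton identities -/

theorem IsMetricOn.gradNormSq_eq (hG : IsMetricOn G U) (hx : x ∈ U) (u : Euc n → ℝ) :
    gradNormSq G u x = ∑ j, ∑ k, (G x)⁻¹ j k * (pd j u x * pd k u x) := by
  unfold gradNormSq
  rw [Finset.sum_comm]
  have : ∀ j, ∑ i, G x i j * grad G u i x * grad G u j x = pd j u x * grad G u j x := fun j => by
    rw [← Finset.sum_mul, hG.sum_mul_grad hx]
  rw [Finset.sum_congr rfl fun j _ => this j]
  simp only [grad, Finset.mul_sum]
  exact Finset.sum_congr rfl fun j _ => Finset.sum_congr rfl fun k _ => by ring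

/-- Instance of `lichnerowicz_hessian_jet`: its two differential hypotheses are one derivative of
`Ric = D²u - g/2` and two derivatives of `Δu + |∇u|² = u + n/2`. -/
theorem solitonOp_hess (hG : IsMetricOn G U) (hx : x ∈ U) (hN : IsNormalAt G x)
    {u : Euc n → ℝ} (hu : ContDiffOn ℝ ∞ u U)
    (hsol : ∀ y ∈ U, ∀ i j, 2 * ricci G i j y + G y i j = lieDeriv (grad G u) G i j y)
    (hnorm : ∀ y ∈ U, gradNormSq G u y + scalarCurv G y = u y) (a b : Fin n) :
    solitonOp G u (hess G u) a b x = 0 := by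
  have hpd {v : Euc n → ℝ} (hv : ContDiffOn ℝ ∞ v U) (c : Fin n) : ContDiffOn ℝ ∞ (pd c v) U :=
    contDiffOn_pd hG.isOpen (k := ⊤) (m := ⊤) hv le_rfl c
  have hcomm {v : Euc n → ℝ} (hv : ContDiffOn ℝ ∞ v U) {y : Euc n} (hy : y ∈ U) (i j : Fin n) :
      pd i (pd j v) y = pd j (pd i v) y := pd_comm (hv.contDiffAt_two hG.isOpen hy) i j
  have hcomm' {v : Euc n → ℝ} (hv : ContDiffOn ℝ ∞ v U) (i j k : Fin n) :
      pd i (pd j (pd k v)) x = pd i (pd k (pd j v)) x :=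
    pd_congr (by filter_upwards [hG.isOpen.mem_nhds hx] with y hy using hcomm hv hy j k) i
  have hcomm'' {v : Euc n → ℝ} (hv : ContDiffOn ℝ ∞ v U) (i j k l : Fin n) :
      pd i (pd j (pd k (pd l v))) x = pd i (pd k (pd j (pd l v))) x := hcomm' (hpd hv l) i j k
  have hric (y : Euc n) (hy : y ∈ U) (i j : Fin n) :
      ricci G i j y = hess G u y i j - (1 / 2) * G y i j := by
    have := hsol y hy i j
    rw [hG.lieDeriv_grad_eq_hess hu hy] at this
    linarith
  -- The trace of the soliton equation gives `R = Δu - n/2`, which is substituted in the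
  -- normalization.
  have hnormal (y : Euc n) (hy : y ∈ U) : (∑ j, ∑ k, (G y)⁻¹ j k *
      (hess G u y j k + pd j u y * pd k u y)) = u y + n / 2 := by
    have h1 := hnorm y hy
    rw [hG.gradNormSq_eq hy, scalarCurv] at h1
    have h2 : ∑ j, ∑ k, (G y)⁻¹ j k * ((1 / 2) * G y j k) = n / 2 := by
      have : ∀ j, ∑ k, (G y)⁻¹ j k * ((1 / 2) * G y j k) = 1 / 2 := fun j => by
        have e := hG.inv_mul hy j j
        rw [if_pos rfl] at e
        calc _ = 1 / 2 * ∑ k, (G y)⁻¹ j k * G y k j := by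
              rw [Finset.mul_sum]
              exact Finset.sum_congr rfl fun k _ => by rw [hG.symm hy j k]; ring
          _ = 1 / 2 := by rw [e, mul_one]
      rw [Finset.sum_congr rfl fun j _ => this j]
      simp [div_eq_mul_inv]
    simp only [hric y hy, mul_sub, Finset.sum_sub_distrib] at h1
    rw [h2] at h1
    simp only [mul_add, Finset.sum_add_distrib]
    linarith
  have key := lichnerowicz_hessian_jet
    (fun i j a b => pd i (pd j (fun y => G y a b)) x)
    (fun i j k a b => pd i (pd j (pd k (fun y => G y a b))) x)
    (fun i => pd i u x) (fun i j => pd i (pd j u) x) (fun i j k => pd i (pd j (pd k u)) x)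
    (fun i j k l => pd i (pd j (pd k (pd l u))) x)
    (fun i c a b => pd i (christoffel G c a b) x)
    (fun i j c a b => pd i (pd j (christoffel G c a b)) x)
    (fun i a b => pd i (fun y => hess G u y a b) x)
    (fun i j a b => pd i (pd j (fun y => hess G u y a b)) x)
    (fun i j a b => hcomm (hG.smooth a b) hx i j)
    (fun i j a b => pd_congr (pd_eventuallyEq (by
      filter_upwards [hG.isOpen.mem_nhds hx] with y hy using hG.symm hy a b) j) i)
    (fun i j k a b => hcomm (hpd (hG.smooth a b) k) hx i j)
    (fun i j k a b => hcomm' (hG.smooth a b) i j k)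
    (fun i j k a b => pd_congr (pd_eventuallyEq (pd_eventuallyEq (by
      filter_upwards [hG.isOpen.mem_nhds hx] with y hy using hG.symm hy a b) k) j) i)
    (fun i j => hcomm hu hx i j)
    (fun i j k => hcomm (hpd hu k) hx i j)
    (fun i j k => hcomm' hu i j k)
    -- The pairs `ij` and `kl` are exchanged by adjacent transpositions of derivatives.
    (fun i j k l => by
      have h3 (i j k l : Fin n) : pd i (pd j (pd k (pd l u))) x = pd i (pd j (pd l (pd k u))) x :=
        pd_congr (pd_eventuallyEq (by
          filter_upwards [hG.isOpen.mem_nhds hx] with y hy using hcomm hu hy k l) j) i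
      rw [hcomm'' hu, hcomm (hpd (hpd hu l) j) hx, h3, hcomm'' hu, h3])
    (fun i c a b => hG.pd_christoffel hx hN i c a b)
    (fun i j c a b => hG.pd_pd_christoffel hx hN i j c a b)
    (fun i a b => hG.pd_hess hx hN hu i a b)
    (fun i j a b => hG.pd_pd_hess hx hN hu i j a b)
    (fun c a b => by
      simp only [← hG.pd_riemann hx hN]
      rw [← hG.pd_ricci hx hN]
      have : ricci G a b =ᶠ[𝓝 x] fun y => hess G u y a b - (1 / 2) * G y a b := by
        filter_upwards [hG.isOpen.mem_nhds hx] with y hy using hric y hy a b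
      have d := (hG.smooth a b).differentiableAt_of_isOpen hG.isOpen hx
      rw [pd_congr this, pd_sub ((hG.smooth_hess hu a b).differentiableAt_of_isOpen hG.isOpen hx)
        (d.const_mul _), pd_const_mul d, hN.pd_eq_zero]
      ring)
    (fun a b => by
      have c0 (j k : Fin n) := (hG.smooth_inv j k).contDiffAt_two hG.isOpen hx
      have c1 (j k : Fin n) := (hG.smooth_hess hu j k).contDiffAt_two hG.isOpen hx
      have c2 (j : Fin n) := (hpd hu j).contDiffAt_two hG.isOpen hx
      have c3 (j k : Fin n) := (c1 j k).add ((c2 j).mul (c2 k))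
      have h1 : (fun y => ∑ j, ∑ k, (G y)⁻¹ j k * (hess G u y j k + pd j u y * pd k u y)) =ᶠ[𝓝 x]
          fun y => u y + n / 2 := by
        filter_upwards [hG.isOpen.mem_nhds hx] with y hy using hnormal y hy
      have h2 := pd_congr (pd_eventuallyEq h1 b) a
      rw [pd_pd_add (hu.contDiffAt_two hG.isOpen hx) contDiffAt_const,
        pd_pd_sum _ fun j _ => ContDiffAt.sum fun k _ => (c0 j k).mul (c3 j k)] at h2
      have h3 : pd b (fun _ : Euc n => (n : ℝ) / 2) = fun _ => 0 := funext fun y => pd_const _ _ _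
      rw [h3, pd_const, add_zero] at h2
      rw [← h2]
      simp only [pd_pd_sum _ fun k _ => (c0 _ k).mul (c3 _ k), pd_pd_mul (c0 _ _) (c3 _ _),
        hG.pd_inv hx hN, hG.pd_pd_inv hx hN]
      simp only [pd_pd_add (c1 _ _) ((c2 _).mul (c2 _)), pd_pd_mul (c2 _) (c2 _), hN.inv_apply]
      simp only [zero_mul, add_zero, Finset.sum_add_distrib, ite_mul, one_mul, Finset.sum_ite_eq,
        Finset.mem_univ, if_true, neg_mul, Finset.sum_neg_distrib, hN.hess_eq]
      have h5 : ∑ j, pd b (pd j u) x * pd a (pd j u) x = ∑ j, pd a (pd j u) x * pd b (pd j u) x :=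
        Finset.sum_congr rfl fun j _ => mul_comm _ _
      have h6 : ∑ j, pd j u x * pd a (pd b (pd j u)) x = ∑ j, pd a (pd b (pd j u)) x * pd j u x :=
        Finset.sum_congr rfl fun j _ => mul_comm _ _
      simp only [h5, h6, mul_assoc, ← Finset.mul_sum]
      ring) a b
  rw [hG.solitonOp_eq hx hN hu fun a b => (hG.smooth_hess hu a b).contDiffAt_two hG.isOpen hx]
  simp only [hN.ricci_eq, hN.riemann_eq, hN.hess_eq]
  exact key

end

end

section

/-! ### Quadratic forms and the second derivative test -/

variable {n : ℕ}

/-- The value `A(v, v)` of the quadratic form of a matrix. -/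
def quadForm (A : Matrix (Fin n) (Fin n) ℝ) (v : Fin n → ℝ) : ℝ :=
  ∑ a, ∑ b, A a b * v a * v b

theorem quadForm_eq (A : Matrix (Fin n) (Fin n) ℝ) (v : Fin n → ℝ) :
    quadForm A v = v ⬝ᵥ A.mulVec v := by
  simp only [quadForm, dotProduct, Matrix.mulVec, Finset.mul_sum]
  exact Finset.sum_congr rfl fun a _ => Finset.sum_congr rfl fun b _ => by ring

theorem quadForm_add_smul (A B : Matrix (Fin n) (Fin n) ℝ) (c d : ℝ) (v : Fin n → ℝ) :
    quadForm (c • A + d • B) v = c * quadForm A v + d * quadForm B v := by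
  simp [quadForm_eq, Matrix.add_mulVec, Matrix.smul_mulVec]

theorem quadForm_smul_right (A : Matrix (Fin n) (Fin n) ℝ) (c : ℝ) (v : Fin n → ℝ) :
    quadForm A (c • v) = c ^ 2 * quadForm A v := by
  simp only [quadForm_eq, Matrix.mulVec_smul, dotProduct_smul, smul_dotProduct, smul_eq_mul]
  ring

theorem posSemidef_of_quadForm_nonneg {A : Matrix (Fin n) (Fin n) ℝ} (hA : ∀ a b, A a b = A b a)
    (h : ∀ v, 0 ≤ quadForm A v) : A.PosSemidef :=
  Matrix.PosSemidef.of_dotProduct_mulVec_nonneg (by ext a b; simp [hA a b])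
    fun v => by simpa [quadForm_eq] using h v

theorem _root_.Matrix.PosDef.quadForm_pos {A : Matrix (Fin n) (Fin n) ℝ} (hA : A.PosDef)
    {v : Fin n → ℝ} (hv : v ≠ 0) : 0 < quadForm A v := by
  simpa [quadForm_eq] using hA.dotProduct_mulVec_pos hv

theorem exists_factor {A : Matrix (Fin n) (Fin n) ℝ} (hA : A.PosSemidef) :
    ∃ B : Matrix (Fin n) (Fin n) ℝ, A = B.transpose * B := by
  open scoped MatrixOrder Matrix.Norms.L2Operator in
  obtain ⟨B, hB⟩ := CStarAlgebra.nonneg_iff_eq_star_mul_self.mp hA.nonneg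
  exact ⟨B, by simpa [Matrix.star_eq_conjTranspose] using hB⟩

/-- The trace of the product of two nonnegative quadratic forms is nonnegative. -/
theorem sum_mul_nonneg_of_quadForm_nonneg {A B : Matrix (Fin n) (Fin n) ℝ}
    (hA : ∀ v, 0 ≤ quadForm A v) (hB : B.PosSemidef) : 0 ≤ ∑ j, ∑ l, A j l * B j l := by
  obtain ⟨C, rfl⟩ := exists_factor hB
  -- With `B = CᵀC`, the trace is the sum of the values of `A` on the rows of `C`.
  have : ∑ j, ∑ l, A j l * (C.transpose * C) j l = ∑ m, quadForm A (C m) := by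
    simp only [Matrix.mul_apply, Finset.mul_sum, quadForm, Matrix.transpose_apply]
    rw [Finset.sum_congr rfl fun j _ => Finset.sum_comm, Finset.sum_comm]
    exact Finset.sum_congr rfl fun m _ => Finset.sum_congr rfl fun j _ =>
      Finset.sum_congr rfl fun l _ => (mul_assoc _ _ _).symm
  rw [this]
  exact Finset.sum_nonneg fun m _ => hA _

/-- Restrict to the coordinate line. A negative second derivative at this critical point would make
the local minimum a local maximum too, hence the function constant nearby and its second derivative
zero. -/
theorem pd_pd_nonneg_of_isLocalMin {u : Euc n → ℝ} {x : Euc n} (hu : ContDiffAt ℝ 2 u x)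
    (hmin : IsLocalMin u x) (j : Fin n) : 0 ≤ pd j (pd j u) x := by
  set e : Euc n := EuclideanSpace.single j 1
  have hline (t : ℝ) : HasDerivAt (fun t : ℝ => x + t • e) e t := by
    simpa using ((hasDerivAt_id t).smul_const e).const_add x
  have hcont : Tendsto (fun t : ℝ => x + t • e) (𝓝 0) (𝓝 x) := by
    have := (hline 0).continuousAt.tendsto
    simpa using this
  have h1 : ∀ᶠ t in 𝓝 (0 : ℝ), deriv (fun t : ℝ => u (x + t • e)) t = pd j u (x + t • e) := by
    filter_upwards [hcont.eventually (eventually_differentiableAt hu)] with t ht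
    exact (ht.hasFDerivAt.comp_hasDerivAt t (hline t)).deriv
  have h2 : deriv (deriv (fun t : ℝ => u (x + t • e))) 0 = pd j (pd j u) x := by
    rw [EventuallyEq.deriv_eq h1]
    have hd : DifferentiableAt ℝ (pd j u) (x + (0 : ℝ) • e) := by
      simpa using differentiableAt_pd hu j
    have := (hd.hasFDerivAt.comp_hasDerivAt 0 (hline 0)).deriv
    simp only [Function.comp_def, zero_smul, add_zero] at this
    exact this
  have hmin' : IsLocalMin (fun t : ℝ => u (x + t • e)) 0 := by
    have : ∀ᶠ y in 𝓝 x, u x ≤ u y := hmin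
    filter_upwards [hcont.eventually this] with t ht
    simpa using ht
  by_contra hneg
  rw [not_le, ← h2] at hneg
  have hc : ContinuousAt (fun t : ℝ => u (x + t • e)) 0 := by
    have : ContinuousAt u (x + (0 : ℝ) • e) := by simpa using hu.continuousAt
    exact ContinuousAt.comp (f := fun t : ℝ => x + t • e) this (hline 0).continuousAt
  have hmax := isLocalMax_of_deriv_deriv_neg hneg hmin'.deriv_eq_zero hc
  have hconst : (fun t : ℝ => u (x + t • e)) =ᶠ[𝓝 0] fun _ => u (x + (0 : ℝ) • e) := by
    have h3 : ∀ᶠ t in 𝓝 (0 : ℝ), u (x + t • e) ≤ u (x + (0 : ℝ) • e) := hmax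
    have h4 : ∀ᶠ t in 𝓝 (0 : ℝ), u (x + (0 : ℝ) • e) ≤ u (x + t • e) := hmin'
    filter_upwards [h3, h4] with t using le_antisymm
  rw [hconst.deriv.deriv_eq] at hneg
  simp at hneg

theorem pd_eq_zero_of_isLocalMin {u : Euc n → ℝ} {x : Euc n} (hmin : IsLocalMin u x) (j : Fin n) :
    pd j u x = 0 := by
  simp [pd, hmin.fderiv_eq_zero]

/-- Contraction of the terms of `Δ_L W + ℒ_X W - W` with a null vector of `W`. -/
theorem contract_null_vector (W : Fin n → Fin n → ℝ) (v : Fin n → ℝ)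
    (hv : ∀ c, ∑ b, W c b * v b = 0) (hv' : ∀ c, ∑ a, W a c * v a = 0)
    (P D : Fin n → Matrix (Fin n) (Fin n) ℝ) (A : Fin n → Fin n → Fin n → ℝ)
    (R : Fin n → Fin n → Fin n → Fin n → ℝ)
    (Q F : Fin n → Fin n → ℝ) (X : Fin n → ℝ) :
    ∑ a, ∑ b, (∑ j, (P j a b - ∑ c, (A j c a * W c b + A j c b * W a c)) +
      2 * (∑ j, ∑ l, R a j b l * W j l) - (∑ p, Q a p * W p b) - (∑ p, Q b p * W a p) +
      ∑ k, (X k * D k a b + W k b * F a k + W a k * F b k) - W a b) * v a * v b =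
    ∑ j, quadForm (P j) v + 2 * ∑ j, ∑ l, (∑ a, ∑ b, R a j b l * v a * v b) * W j l +
      ∑ k, X k * quadForm (D k) v := by
  -- A term in which one index of `W` is free is contracted with `v` in that index, so it vanishes.
  -- Only the curvature term, where both indices of `W` are summed, and the derivatives of `W`
  -- escape this.
  have h1 (K : Fin n → ℝ) (c : Fin n) : ∑ a, ∑ b, K a * W c b * v a * v b = 0 := by
    refine Finset.sum_eq_zero fun a _ => ?_
    rw [← mul_zero (K a * v a), ← hv c, Finset.mul_sum]
    exact Finset.sum_congr rfl fun b _ => by ring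
  have h2 (K : Fin n → ℝ) (c : Fin n) : ∑ a, ∑ b, K b * W a c * v a * v b = 0 := by
    rw [Finset.sum_comm]
    refine Finset.sum_eq_zero fun b _ => ?_
    rw [← mul_zero (K b * v b), ← hv' c, Finset.mul_sum]
    exact Finset.sum_congr rfl fun a _ => by ring
  have h3 (Y : Fin n → Fin n → Fin n → ℝ) : ∑ a, ∑ b, (∑ s, Y s a b) * v a * v b =
      ∑ s, ∑ a, ∑ b, Y s a b * v a * v b := by
    simp only [Finset.sum_mul]
    rw [Finset.sum_comm]
    rw [Finset.sum_congr rfl fun b _ => Finset.sum_comm, Finset.sum_comm]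
    exact Finset.sum_congr rfl fun s _ => Finset.sum_comm
  have h4 : ∑ a, ∑ b, W a b * v a * v b = 0 := by
    refine Finset.sum_eq_zero fun a _ => ?_
    rw [← mul_zero (v a), ← hv a, Finset.mul_sum]
    exact Finset.sum_congr rfl fun b _ => by ring
  have h5 : ∑ j, ∑ l, (∑ a, ∑ b, R a j b l * v a * v b) * W j l =
      ∑ a, ∑ b, (∑ j, ∑ l, R a j b l * W j l) * v a * v b := by
    rw [h3 fun j a b => ∑ l, R a j b l * W j l]
    refine Finset.sum_congr rfl fun j _ => ?_
    rw [h3 fun l a b => R a j b l * W j l]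
    refine Finset.sum_congr rfl fun l _ => ?_
    simp only [Finset.sum_mul]
    exact Finset.sum_congr rfl fun a _ => Finset.sum_congr rfl fun b _ => by ring
  have e (a b : Fin n) : (∑ j, (P j a b - ∑ c, (A j c a * W c b + A j c b * W a c)) +
      2 * (∑ j, ∑ l, R a j b l * W j l) - (∑ p, Q a p * W p b) - (∑ p, Q b p * W a p) +
      ∑ k, (X k * D k a b + W k b * F a k + W a k * F b k) - W a b) * v a * v b =
      (∑ j, P j a b) * v a * v b - (∑ j, ∑ c, A j c a * W c b) * v a * v b -
      (∑ j, ∑ c, A j c b * W a c) * v a * v b +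
      2 * ((∑ j, ∑ l, R a j b l * W j l) * v a * v b) - (∑ p, Q a p * W p b) * v a * v b -
      (∑ p, Q b p * W a p) * v a * v b + (∑ k, X k * D k a b) * v a * v b +
      (∑ k, F a k * W k b) * v a * v b + (∑ k, F b k * W a k) * v a * v b - W a b * v a * v b := by
    simp only [Finset.sum_add_distrib, Finset.sum_sub_distrib, mul_comm (F _ _)]
    ring
  rw [Finset.sum_congr rfl fun a _ => Finset.sum_congr rfl fun b _ => e a b]
  simp only [Finset.sum_add_distrib, Finset.sum_sub_distrib]
  rw [h3 P, h3 fun j a b => ∑ c, A j c a * W c b, h3 fun j a b => ∑ c, A j c b * W a c,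
    h3 fun p a b => Q a p * W p b, h3 fun p a b => Q b p * W a p, h3 fun k a b => X k * D k a b,
    h3 fun k a b => F a k * W k b, h3 fun k a b => F b k * W a k, h4]
  simp only [h3, h1 (fun a => A _ _ a), h2 (fun a => A _ _ a), h1 (fun a => Q a _),
    h2 (fun a => Q a _), h1 (fun a => F a _), h2 (fun a => F a _)]
  rw [h5]
  simp only [Finset.sum_const_zero, quadForm, Finset.mul_sum, sub_zero, add_zero, mul_assoc]

/-! ### The touching argument at a point -/

section

variable {G : Euc n → Matrix (Fin n) (Fin n) ℝ} {U : Set (Euc n)} {x : Euc n}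

theorem solitonOp_add_smul (hG : IsMetricOn G U) (hx : x ∈ U) (hN : IsNormalAt G x)
    {u : Euc n → ℝ} (hu : ContDiffOn ℝ ∞ u U) {S T : Euc n → Matrix (Fin n) (Fin n) ℝ}
    (hS : ∀ a b, ContDiffAt ℝ 2 (fun y => S y a b) x)
    (hT : ∀ a b, ContDiffAt ℝ 2 (fun y => T y a b) x) (c d : ℝ) (a b : Fin n) :
    solitonOp G u (fun y => c • S y + d • T y) a b x =
      c * solitonOp G u S a b x + d * solitonOp G u T a b x := by
  have d1 (a b : Fin n) := (hS a b).differentiableAt (by norm_num)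
  have d2 (a b : Fin n) := (hT a b).differentiableAt (by norm_num)
  have c1 (a b : Fin n) : ContDiffAt ℝ 2 (fun y => c * S y a b) x := contDiffAt_const.mul (hS a b)
  have c2 (a b : Fin n) : ContDiffAt ℝ 2 (fun y => d * T y a b) x := contDiffAt_const.mul (hT a b)
  rw [hG.solitonOp_eq hx hN hu hS, hG.solitonOp_eq hx hN hu hT,
    hG.solitonOp_eq (T := fun y => c • S y + d • T y) hx hN hu fun a b => (c1 a b).add (c2 a b)]
  simp only [Matrix.add_apply, Matrix.smul_apply, smul_eq_mul, pd_pd_add (c1 _ _) (c2 _ _),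
    pd_pd_const_mul (hS _ _), pd_pd_const_mul (hT _ _),
    pd_add ((d1 _ _).const_mul c) ((d2 _ _).const_mul d), pd_const_mul (d1 _ _),
    pd_const_mul (d2 _ _), mul_add, add_mul, Finset.sum_add_distrib, Finset.sum_sub_distrib,
    Finset.mul_sum, mul_sub, mul_left_comm _ c, mul_left_comm _ d, mul_assoc]
  ring

/-- The metric is parallel and its curvature terms `2 Ric - Ric - Ric` cancel, so `Δ_L g = 0`; what
remains is `ℒ_X g - g`, given by the soliton equation. -/
theorem solitonOp_metric (hG : IsMetricOn G U) (hx : x ∈ U) (hN : IsNormalAt G x)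
    {u : Euc n → ℝ} (hu : ContDiffOn ℝ ∞ u U)
    (hsol : ∀ y ∈ U, ∀ i j, 2 * ricci G i j y + G y i j = lieDeriv (grad G u) G i j y)
    (a b : Fin n) : solitonOp G u G a b x = 2 * ricci G a b x := by
  have hric (i j : Fin n) : 2 * ricci G i j x + G x i j = 2 * pd i (pd j u) x := by
    rw [hsol x hx, hG.lieDeriv_grad_eq_hess hu hx, hN.hess_eq]
  have hcomm : pd b (pd a u) x = pd a (pd b u) x := pd_comm (hu.contDiffAt_two hG.isOpen hx) b a
  rw [hG.solitonOp_eq hx hN hu fun a b => (hG.smooth a b).contDiffAt_two hG.isOpen hx]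
  -- Metric compatibility, differentiated once at the centre: this is why the rough Laplacian of `g`
  -- vanishes.
  have h1 (j : Fin n) : pd j (pd j (fun y => G y a b)) x =
      pd j (christoffel G b j a) x + pd j (christoffel G a j b) x := by
    have hs (c d : Fin n) : (fun y => G y c d) =ᶠ[𝓝 x] fun y => G y d c := by
      filter_upwards [hG.isOpen.mem_nhds hx] with y hy using hG.symm hy c d
    rw [hG.pd_christoffel hx hN, hG.pd_christoffel hx hN,
      pd_congr (pd_eventuallyEq (hs b a) j) j, pd_congr (pd_eventuallyEq (hs j b) a) j,
      pd_congr (pd_eventuallyEq (hs j a) b) j]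
    ring
  have h2 : ∑ j, riemann G a j b j x = ricci G a b x := (hN.ricci_eq a b).symm
  have h3 := hric a b
  have h4 := hric b a
  have h5 := hG.symm hx a b
  simp [h1, hN.apply, hN.pd_eq_zero, h2, Finset.sum_add_distrib] at h3 h4 h5 ⊢
  linarith

/-- At the centre of normal coordinates, a solution of the Lichnerowicz equation cannot touch a
positive multiple of `2 Ric + g / 2 = 2 D²u - g / 2` from below. -/
theorem not_touching (hG : IsMetricOn G U) (hx : x ∈ U) (hN : IsNormalAt G x)
    {u : Euc n → ℝ} (hu : ContDiffOn ℝ ∞ u U)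
    (hsol : ∀ y ∈ U, ∀ i j, 2 * ricci G i j y + G y i j = lieDeriv (grad G u) G i j y)
    (hnorm : ∀ y ∈ U, gradNormSq G u y + scalarCurv G y = u y)
    (hricci : ∀ v : Fin n → ℝ, v ≠ 0 → 0 < ∑ a, ∑ b, ricci G a b x * v a * v b)
    (hsec : ∀ v w : Fin n → ℝ, 0 ≤ ∑ j, ∑ l, (∑ a, ∑ b, riemann G a j b l x * v a * v b) * w j * w l)
    {T : Euc n → Matrix (Fin n) (Fin n) ℝ} (hT : ∀ a b, ContDiffAt ℝ 2 (fun y => T y a b) x)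
    (hTsymm : ∀ a b, T x a b = T x b a) (hTeq : ∀ a b, solitonOp G u T a b x = 0)
    {θ : ℝ} (hθ : 0 < θ)
    (hle : ∀ y ∈ U, ∀ v, quadForm (T y) v ≤
      θ * quadForm ((2 : ℝ) • hess G u y + (-1 / 2 : ℝ) • G y) v)
    {v : Fin n → ℝ} (hv : v ≠ 0)
    (heq : quadForm (T x) v = θ * quadForm ((2 : ℝ) • hess G u x + (-1 / 2 : ℝ) • G x) v) : False := by
  have cH (a b : Fin n) := (hG.smooth_hess hu a b).contDiffAt_two hG.isOpen hx
  have cG (a b : Fin n) := (hG.smooth a b).contDiffAt_two hG.isOpen hx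
  set B : Euc n → Matrix (Fin n) (Fin n) ℝ := fun y => (2 : ℝ) • hess G u y + (-1 / 2 : ℝ) • G y
  have cB (a b : Fin n) : ContDiffAt ℝ 2 (fun y => B y a b) x :=
    (contDiffAt_const.mul (cH a b)).add (contDiffAt_const.mul (cG a b))
  set W : Euc n → Matrix (Fin n) (Fin n) ℝ := fun y => θ • B y + (-1 : ℝ) • T y with hW
  have cW (a b : Fin n) : ContDiffAt ℝ 2 (fun y => W y a b) x :=
    (contDiffAt_const.mul (cB a b)).add (contDiffAt_const.mul (hT a b))
  -- The multiple of `D²u` in `B` contributes nothing and `-g/2` contributes `-Ric`; the factor `θ`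
  -- is carried along.
  have hop (a b : Fin n) : solitonOp G u W a b x = -θ * ricci G a b x := by
    rw [solitonOp_add_smul hG hx hN hu cB hT, solitonOp_add_smul hG hx hN hu cH cG, hTeq,
      solitonOp_hess hG hx hN hu hsol hnorm, solitonOp_metric hG hx hN hu hsol]
    ring
  have hWq (y : Euc n) (w : Fin n → ℝ) : quadForm (W y) w =
      θ * quadForm (B y) w - quadForm (T y) w := by
    rw [hW, quadForm_add_smul]; ring
  have hWnn (y : Euc n) (hy : y ∈ U) (w : Fin n → ℝ) : 0 ≤ quadForm (W y) w := by
    rw [hWq]; exact sub_nonneg.2 (hle y hy w)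
  have hWv : quadForm (W x) v = 0 := by rw [hWq, heq, sub_self]
  have hWsymm (a b : Fin n) : W x a b = W x b a := by
    simp only [hW, B, Matrix.add_apply, Matrix.smul_apply, hN.hess_eq, hTsymm a b, hG.symm hx a b,
      pd_comm (hu.contDiffAt_two hG.isOpen hx) a b]
  have hpsd := posSemidef_of_quadForm_nonneg hWsymm (hWnn x hx)
  -- A nonnegative form that vanishes on `(v, v)` has `v` in its kernel.
  have hnull : (W x).mulVec v = 0 := by
    rw [← hpsd.dotProduct_mulVec_zero_iff]
    simpa [quadForm_eq] using hWv
  have hnull1 (c : Fin n) : ∑ b, W x c b * v b = 0 := congr_fun hnull c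
  have hnull2 (c : Fin n) : ∑ a, W x a c * v a = 0 := by
    simpa only [hWsymm c] using hnull1 c
  have cv : ContDiffAt ℝ 2 (fun y => quadForm (W y) v) x :=
    ContDiffAt.sum fun a _ => ContDiffAt.sum fun b _ =>
      ((cW a b).mul contDiffAt_const).mul contDiffAt_const
  -- Here `v` is extended with constant coordinates. It need not be parallel to second order, since
  -- the resulting correction terms contract `W` with `v`.
  have hmin : IsLocalMin (fun y => quadForm (W y) v) x := by
    filter_upwards [hG.isOpen.mem_nhds hx] with y hy
    rw [hWv]; exact hWnn y hy v
  have hq (y : Euc n) : quadForm (W y) v = ∑ a, ∑ b, v a * v b * W y a b :=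
    Finset.sum_congr rfl fun a _ => Finset.sum_congr rfl fun b _ => by ring
  have cc (a b : Fin n) : ContDiffAt ℝ 2 (fun y => v a * v b * W y a b) x :=
    contDiffAt_const.mul (cW a b)
  have hpd (k : Fin n) : quadForm (Matrix.of fun a b => pd k (fun y => W y a b) x) v = 0 := by
    rw [← pd_eq_zero_of_isLocalMin hmin k]
    simp only [hq]
    rw [pd_sum _ fun a _ => DifferentiableAt.fun_sum fun b _ =>
      (cc a b).differentiableAt (by norm_num)]
    simp only [pd_sum _ fun b _ => (cc _ b).differentiableAt (by norm_num),
      pd_const_mul ((cW _ _).differentiableAt (by norm_num)), quadForm, Matrix.of_apply]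
    exact Finset.sum_congr rfl fun a _ => Finset.sum_congr rfl fun b _ => by ring
  have hpdpd (j : Fin n) :
      0 ≤ quadForm (Matrix.of fun a b => pd j (pd j (fun y => W y a b)) x) v := by
    refine (pd_pd_nonneg_of_isLocalMin cv hmin j).trans_eq ?_
    simp only [hq]
    rw [pd_pd_sum _ fun a _ => ContDiffAt.sum fun b _ => cc a b]
    simp only [pd_pd_sum _ fun b _ => cc _ b, pd_pd_const_mul (cW _ _), quadForm, Matrix.of_apply]
    exact Finset.sum_congr rfl fun a _ => Finset.sum_congr rfl fun b _ => by ring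
  have hcon := contract_null_vector (W x) v hnull1 hnull2
    (fun j => Matrix.of fun a b => pd j (pd j (fun y => W y a b)) x)
    (fun k => Matrix.of fun a b => pd k (fun y => W y a b) x)
    (fun j c a => pd j (christoffel G c j a) x) (fun a j b l => riemann G a j b l x)
    (fun a p => ricci G a p x) (fun a k => pd a (pd k u) x) (fun k => pd k u x)
  have hlhs : ∑ a, ∑ b, solitonOp G u W a b x * v a * v b =
      -θ * ∑ a, ∑ b, ricci G a b x * v a * v b := by
    simp only [hop, Finset.mul_sum]
    exact Finset.sum_congr rfl fun a _ => Finset.sum_congr rfl fun b _ => by ring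
  simp only [hG.solitonOp_eq hx hN hu cW] at hlhs
  simp only [Matrix.of_apply] at hcon
  rw [hcon] at hlhs
  have h1 : 0 ≤ ∑ j, quadForm (Matrix.of fun a b => pd j (pd j (fun y => W y a b)) x) v :=
    Finset.sum_nonneg fun j _ => hpdpd j
  -- The curvature term: both `w ↦ R(v, w, v, w)` and `W` are nonnegative forms.
  have h2 := sum_mul_nonneg_of_quadForm_nonneg
    (A := Matrix.of fun j l => ∑ a, ∑ b, riemann G a j b l x * v a * v b) (hsec v) hpsd
  simp only [Matrix.of_apply] at h2
  have h3 := mul_pos hθ (hricci v hv)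
  simp only [hpd, mul_zero, Finset.sum_const_zero] at hlhs
  linarith

end

end

section

variable {n : ℕ}

/-! ### Changes of coordinates -/

theorem differentiableAt_sum_smul {ι E F : Type*} [Fintype ι] [NormedAddCommGroup E]
    [NormedSpace ℝ E] [NormedAddCommGroup F] [NormedSpace ℝ F] {c : ι → ι → E → ℝ} {x : E}
    (hc : ∀ k l, DifferentiableAt ℝ (c k l) x) (P : ι → ι → F) :
    DifferentiableAt ℝ (fun y => ∑ k, ∑ l, c k l y • P k l) x :=
  DifferentiableAt.fun_sum fun k _ => DifferentiableAt.fun_sum fun l _ => (hc k l).smul_const _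

/-- Derivative of the pullback of a bilinear form. -/
theorem fderiv_pullback {E : Type*} [NormedAddCommGroup E] [NormedSpace ℝ E]
    {B : E → E →L[ℝ] E →L[ℝ] ℝ} {τ : E → E} {y : E}
    (hB : DifferentiableAt ℝ B (τ y)) (hτ : ContDiffAt ℝ 2 τ y) (a b c : E) :
    fderiv ℝ (fun z => B (τ z) (fderiv ℝ τ z a) (fderiv ℝ τ z b)) y c =
      fderiv ℝ B (τ y) (fderiv ℝ τ y c) (fderiv ℝ τ y a) (fderiv ℝ τ y b) +
      B (τ y) (fderiv ℝ (fderiv ℝ τ) y c a) (fderiv ℝ τ y b) +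
      B (τ y) (fderiv ℝ τ y a) (fderiv ℝ (fderiv ℝ τ) y c b) := by
  have d1 := (hτ.differentiableAt (by norm_num)).hasFDerivAt
  have d2 : HasFDerivAt (fderiv ℝ τ) (fderiv ℝ (fderiv ℝ τ) y) y :=
    ((hτ.fderiv_right (m := 1) (by norm_num)).differentiableAt (by norm_num)).hasFDerivAt
  have d3 := HasFDerivAt.comp (F := E) (G := E →L[ℝ] E →L[ℝ] ℝ) y hB.hasFDerivAt d1
  have d4 (a : E) := d2.clm_apply (hasFDerivAt_const a y)
  have := ((d3.clm_apply (d4 a)).clm_apply (d4 b)).fderiv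
  simp only [Function.comp_apply] at this
  rw [this]
  simp
  ring

theorem fderiv_bilinear_apply {E : Type*} [NormedAddCommGroup E] [NormedSpace ℝ E]
    {B : E → E →L[ℝ] E →L[ℝ] ℝ} {y : E} (hB : DifferentiableAt ℝ B y) (a b c : E) :
    fderiv ℝ (fun z => B z a b) y c = fderiv ℝ B y c a b := by
  have := ((hB.hasFDerivAt.clm_apply (hasFDerivAt_const a y)).clm_apply (hasFDerivAt_const b y)).fderiv
  rw [this]
  simp

/-- The bilinear form with matrix `A`. -/
def bilin (A : Matrix (Fin n) (Fin n) ℝ) : Euc n →L[ℝ] Euc n →L[ℝ] ℝ :=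
  ∑ k, ∑ l, A k l • (EuclideanSpace.proj k : Euc n →L[ℝ] ℝ).smulRight
    (EuclideanSpace.proj l : Euc n →L[ℝ] ℝ)

theorem bilin_apply (A : Matrix (Fin n) (Fin n) ℝ) (a b : Euc n) :
    bilin A a b = ∑ k, ∑ l, A k l * a k * b l := by
  simp [bilin, mul_assoc]

theorem bilin_self (A : Matrix (Fin n) (Fin n) ℝ) (a : Euc n) :
    bilin A a a = quadForm A a := bilin_apply A a a

theorem bilin_comm {A : Matrix (Fin n) (Fin n) ℝ} (hA : ∀ i j, A i j = A j i) (a b : Euc n) :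
    bilin A a b = bilin A b a := by
  rw [bilin_apply, bilin_apply, Finset.sum_comm]
  exact Finset.sum_congr rfl fun k _ => Finset.sum_congr rfl fun l _ => by rw [hA]; ring

theorem bilin_single (A : Matrix (Fin n) (Fin n) ℝ) (i j : Fin n) :
    bilin A (EuclideanSpace.single i 1) (EuclideanSpace.single j 1) = A i j := by
  simp [bilin_apply]

theorem differentiableAt_bilin {G : Euc n → Matrix (Fin n) (Fin n) ℝ} {x : Euc n}
    (hG : ∀ a b, DifferentiableAt ℝ (fun y => G y a b) x) :
    DifferentiableAt ℝ (fun y => bilin (G y)) x := by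
  exact differentiableAt_sum_smul (F := Euc n →L[ℝ] Euc n →L[ℝ] ℝ) hG fun k l =>
    (EuclideanSpace.proj k : Euc n →L[ℝ] ℝ).smulRight (EuclideanSpace.proj l : Euc n →L[ℝ] ℝ)

theorem sum_smul_single (u : Euc n) : ∑ i, u i • EuclideanSpace.single i (1 : ℝ) = u := by
  ext j; simp [Pi.single_apply]

theorem fderiv_apply_eq_sum {F : Type*} [NormedAddCommGroup F] [NormedSpace ℝ F] (L : Euc n →L[ℝ] F)
    (u : Euc n) : L u = ∑ i, u i • L (EuclideanSpace.single i 1) := by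
  conv_lhs => rw [← sum_smul_single u]
  simp

theorem fderiv_bilin_apply {G : Euc n → Matrix (Fin n) (Fin n) ℝ} {x : Euc n}
    (hG : ∀ a b, DifferentiableAt ℝ (fun y => G y a b) x) (c a b : Euc n) :
    fderiv ℝ (fun y => bilin (G y)) x c a b =
      ∑ i, ∑ k, ∑ l, pd i (fun y => G y k l) x * c i * a k * b l := by
  have h (i : Fin n) (k l : Fin n) : fderiv ℝ (fun y => bilin (G y)) x (EuclideanSpace.single i 1)
      (EuclideanSpace.single k 1) (EuclideanSpace.single l 1) = pd i (fun y => G y k l) x := by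
    have h1 : (fun y => G y k l) = fun y => bilin (G y) (EuclideanSpace.single k 1)
      (EuclideanSpace.single l 1) := funext fun y => (bilin_single _ _ _).symm
    rw [h1, pd, fderiv_bilinear_apply (differentiableAt_bilin hG)]
  rw [fderiv_apply_eq_sum (fderiv ℝ (fun y => bilin (G y)) x) c]
  simp only [_root_.sum_apply, _root_.smul_apply]
  refine Finset.sum_congr rfl fun i _ => ?_
  rw [fderiv_apply_eq_sum (fderiv ℝ (fun y => bilin (G y)) x (EuclideanSpace.single i 1)) a]
  simp only [_root_.sum_apply, _root_.smul_apply, Finset.smul_sum]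
  refine Finset.sum_congr rfl fun k _ => ?_
  rw [fderiv_apply_eq_sum (fderiv ℝ (fun y => bilin (G y)) x (EuclideanSpace.single i 1)
    (EuclideanSpace.single k 1)) b]
  simp only [smul_eq_mul, h, Finset.mul_sum]
  exact Finset.sum_congr rfl fun l _ => by ring

theorem fderiv_fderiv_apply_eq_sum {u : Euc n → ℝ} {x : Euc n} (hu : ContDiffAt ℝ 2 u x)
    (a b : Euc n) : fderiv ℝ (fderiv ℝ u) x a b = ∑ i, ∑ j, pd i (pd j u) x * a i * b j := by
  have hd : DifferentiableAt ℝ (fderiv ℝ u) x :=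
    (hu.fderiv_right (m := 1) (by norm_num)).differentiableAt (by norm_num)
  have h (i j : Fin n) : pd i (pd j u) x =
      fderiv ℝ (fderiv ℝ u) x (EuclideanSpace.single i 1) (EuclideanSpace.single j 1) := by
    have : pd j u = fun y => fderiv ℝ u y (EuclideanSpace.single j 1) := rfl
    rw [this, pd, fderiv_clm_apply hd (differentiableAt_const _)]
    simp
  rw [fderiv_apply_eq_sum (fderiv ℝ (fderiv ℝ u) x) a]
  simp only [_root_.sum_apply, _root_.smul_apply]
  refine Finset.sum_congr rfl fun i _ => ?_
  rw [fderiv_apply_eq_sum (fderiv ℝ (fderiv ℝ u) x (EuclideanSpace.single i 1)) b]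
  simp only [smul_eq_mul, h, Finset.mul_sum]
  exact Finset.sum_congr rfl fun l _ => by ring

/-! ### Invariance of the Lie derivative of a metric along a gradient -/

section

variable {G : Euc n → Matrix (Fin n) (Fin n) ℝ} {U : Set (Euc n)} {x : Euc n}

/-- The gradient as a vector. -/
def gradVec (G : Euc n → Matrix (Fin n) (Fin n) ℝ) (u : Euc n → ℝ) (x : Euc n) : Euc n :=
  WithLp.toLp 2 fun i => grad G u i x

theorem IsMetricOn.bilin_gradVec (hG : IsMetricOn G U) (hx : x ∈ U) (u : Euc n → ℝ) (b : Euc n) :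
    bilin (G x) (gradVec G u x) b = fderiv ℝ u x b := by
  rw [fderiv_apply_eq_sum (fderiv ℝ u x) b, bilin_apply, Finset.sum_comm]
  refine Finset.sum_congr rfl fun j _ => ?_
  rw [← Finset.sum_mul, smul_eq_mul, mul_comm]
  exact congrArg _ (hG.sum_mul_grad hx u j)

/-- This form with Fréchet derivatives in place of indices is the one to which the chain rule can be
applied under a change of coordinates. -/
theorem IsMetricOn.quadForm_lieDeriv_grad (hG : IsMetricOn G U) (hx : x ∈ U) {u : Euc n → ℝ}
    (hu : ContDiffOn ℝ ∞ u U) (w : Euc n) :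
    quadForm (Matrix.of fun i j => lieDeriv (grad G u) G i j x) w =
      2 * fderiv ℝ (fderiv ℝ u) x w w -
      2 * fderiv ℝ (fun y => bilin (G y)) x w (gradVec G u x) w +
      fderiv ℝ (fun y => bilin (G y)) x (gradVec G u x) w w := by
  have d (a b : Fin n) := (hG.smooth a b).differentiableAt_of_isOpen hG.isOpen hx
  have hs (i j : Fin n) : (fun y => G y i j) =ᶠ[𝓝 x] fun y => G y j i := by
    filter_upwards [hG.isOpen.mem_nhds hx] with y hy using hG.symm hy i j
  rw [fderiv_fderiv_apply_eq_sum (hu.contDiffAt_two hG.isOpen hx), fderiv_bilin_apply d,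
    fderiv_bilin_apply d]
  simp only [quadForm, Matrix.of_apply, hG.lieDeriv_grad_eq hu hx]
  have e1 : ∑ i, ∑ k, ∑ j, pd i (fun y => G y k j) x * w i * (gradVec G u x) k * w j =
      ∑ i, ∑ j, ∑ k, pd i (fun y => G y k j) x * w i * (gradVec G u x) k * w j :=
    Finset.sum_congr rfl fun i _ => Finset.sum_comm
  have e2 : ∑ i, ∑ k, ∑ j, pd i (fun y => G y k j) x * w i * (gradVec G u x) k * w j =
      ∑ j, ∑ i, ∑ k, pd i (fun y => G y k j) x * w i * (gradVec G u x) k * w j := by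
    rw [e1, Finset.sum_comm]
  have e3 : ∑ k, ∑ i, ∑ j, pd k (fun y => G y i j) x * (gradVec G u x) k * w i * w j =
      ∑ i, ∑ j, ∑ k, pd k (fun y => G y i j) x * (gradVec G u x) k * w i * w j := by
    rw [Finset.sum_comm]
    exact Finset.sum_congr rfl fun i _ => Finset.sum_comm
  rw [two_mul (∑ i, ∑ k, ∑ j, _)]
  -- The factor 2 is split into two copies with the roles of the two tensor indices exchanged, one
  -- for each of the terms `∂_i g_kj` and `∂_j g_ik`.
  nth_rewrite 2 [e2]
  rw [e1, e3]
  rw [Finset.mul_sum, ← Finset.sum_add_distrib, ← Finset.sum_sub_distrib, ← Finset.sum_add_distrib]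
  refine Finset.sum_congr rfl fun i _ => ?_
  rw [Finset.mul_sum, ← Finset.sum_add_distrib, ← Finset.sum_sub_distrib, ← Finset.sum_add_distrib]
  refine Finset.sum_congr rfl fun j _ => ?_
  have e4 : ∑ k, grad G u k x * (pd i (fun y => G y k j) x + pd j (fun y => G y i k) x -
      pd k (fun y => G y i j) x) * w i * w j =
      ∑ k, pd i (fun y => G y k j) x * w i * (gradVec G u x) k * w j +
      ∑ k, pd j (fun y => G y k i) x * w j * (gradVec G u x) k * w i -
      ∑ k, pd k (fun y => G y i j) x * (gradVec G u x) k * w i * w j := by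
    rw [← Finset.sum_add_distrib, ← Finset.sum_sub_distrib]
    refine Finset.sum_congr rfl fun k _ => ?_
    have hg : (gradVec G u x) k = grad G u k x := rfl
    rw [pd_congr (hs i k), hg]
    ring
  rw [sub_mul, sub_mul, Finset.sum_mul, Finset.sum_mul, e4]
  ring

/-- `τ` pulls `G` and `u` back to `G'` and `u'` near `y`. -/
theorem quadForm_lieDeriv_grad_pullback {G' : Euc n → Matrix (Fin n) (Fin n) ℝ} {U' : Set (Euc n)}
    {u u' : Euc n → ℝ} {τ : Euc n → Euc n} {y : Euc n}
    (hG : IsMetricOn G U) (hG' : IsMetricOn G' U') (hu : ContDiffOn ℝ ∞ u U)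
    (hu' : ContDiffOn ℝ ∞ u' U') (hy : y ∈ U') (hτy : τ y ∈ U) (hτ : ContDiffAt ℝ 2 τ y)
    (hsurj : Function.Surjective (fderiv ℝ τ y))
    (hGG' : ∀ᶠ z in 𝓝 y, ∀ a b, bilin (G' z) a b = bilin (G (τ z)) (fderiv ℝ τ z a) (fderiv ℝ τ z b))
    (huu' : u' =ᶠ[𝓝 y] u ∘ τ) (w : Euc n) :
    quadForm (Matrix.of fun i j => lieDeriv (grad G' u') G' i j y) w =
      quadForm (Matrix.of fun i j => lieDeriv (grad G u) G i j (τ y)) (fderiv ℝ τ y w) := by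
  have dG' := differentiableAt_bilin
    fun a b => (hG'.smooth a b).differentiableAt_of_isOpen hG'.isOpen hy
  have dG := differentiableAt_bilin
    fun a b => (hG.smooth a b).differentiableAt_of_isOpen hG.isOpen hτy
  have cu := hu.contDiffAt_two hG.isOpen hτy
  have hder (a b c : Euc n) : fderiv ℝ (fun z => bilin (G' z)) y c a b =
      fderiv ℝ (fun z => bilin (G z)) (τ y) (fderiv ℝ τ y c) (fderiv ℝ τ y a) (fderiv ℝ τ y b) +
      bilin (G (τ y)) (fderiv ℝ (fderiv ℝ τ) y c a) (fderiv ℝ τ y b) +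
      bilin (G (τ y)) (fderiv ℝ τ y a) (fderiv ℝ (fderiv ℝ τ) y c b) := by
    rw [← fderiv_pullback (B := fun z => bilin (G z)) dG hτ]
    have e : (fun z => bilin (G' z) a b) =ᶠ[𝓝 y]
        fun z => bilin (G (τ z)) (fderiv ℝ τ z a) (fderiv ℝ τ z b) := by
      filter_upwards [hGG'] with z hz using hz a b
    rw [← e.fderiv_eq, fderiv_bilinear_apply dG']
  have dτ := hτ.differentiableAt (n := 2) (by norm_num)
  have hfd : fderiv ℝ u' =ᶠ[𝓝 y] fun z => (fderiv ℝ u (τ z)).comp (fderiv ℝ τ z) := by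
    have h1 : ∀ᶠ z in 𝓝 y, DifferentiableAt ℝ u (τ z) :=
      dτ.continuousAt.eventually (eventually_differentiableAt cu)
    filter_upwards [huu'.eventuallyEq_nhds, h1, hτ.eventually (by norm_num)] with z hz h2 h3
    rw [hz.fderiv_eq, fderiv_comp _ h2 (h3.differentiableAt (by norm_num))]
  have hfd2 (a b : Euc n) : fderiv ℝ (fderiv ℝ u') y a b =
      fderiv ℝ (fderiv ℝ u) (τ y) (fderiv ℝ τ y a) (fderiv ℝ τ y b) +
      fderiv ℝ u (τ y) (fderiv ℝ (fderiv ℝ τ) y a b) := by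
    rw [hfd.fderiv_eq]
    have d2 : HasFDerivAt (fderiv ℝ τ) (fderiv ℝ (fderiv ℝ τ) y) y :=
      ((hτ.fderiv_right (m := 1) (by norm_num)).differentiableAt (by norm_num)).hasFDerivAt
    have d3 : HasFDerivAt (fderiv ℝ u) (fderiv ℝ (fderiv ℝ u) (τ y)) (τ y) :=
      ((cu.fderiv_right (m := 1) (by norm_num)).differentiableAt (by norm_num)).hasFDerivAt
    have := ((d3.comp y dτ.hasFDerivAt).clm_comp d2).fderiv
    simp only [Function.comp_apply] at this
    rw [this]
    simp [add_comm]
  -- Gradients correspond under an isometry. If they did not, pair the difference with itself: by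
  -- surjectivity it is the image of some `b`, and its squared length is the zero difference of the
  -- two values of `du'` on `b`.
  have hX : fderiv ℝ τ y (gradVec G' u' y) = gradVec G u (τ y) := by
    by_contra hne
    have hne' := sub_ne_zero.2 hne
    obtain ⟨b, hb⟩ := hsurj (fderiv ℝ τ y (gradVec G' u' y) - gradVec G u (τ y))
    have h1 := hG'.bilin_gradVec hy u' b
    rw [hGG'.self_of_nhds, hfd.self_of_nhds, ContinuousLinearMap.comp_apply,
      ← hG.bilin_gradVec hτy, ← sub_eq_zero, ← _root_.sub_apply, ← map_sub, hb,
      bilin_self] at h1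
    refine ((hG.posDef _ hτy).quadForm_pos (fun h => hne' ?_)).ne' h1
    ext i; exact congr_fun h i
  have hsym : fderiv ℝ (fderiv ℝ τ) y (gradVec G' u' y) w =
      fderiv ℝ (fderiv ℝ τ) y w (gradVec G' u' y) := hτ.isSymmSndFDerivAt (by simp) _ _
  have hc := bilin_comm (A := G (τ y)) fun i j => hG.symm hτy i j
  -- All second derivatives of `τ` cancel: `2 du(D²τ(w, w))` against `2 g(X, D²τ(w, w))`, and the
  -- terms with `D²τ(w, X')` by its symmetry.
  rw [hG'.quadForm_lieDeriv_grad hy hu', hG.quadForm_lieDeriv_grad hτy hu, hder, hder, hfd2, hX, hsym,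
    ← hG.bilin_gradVec hτy, hc (fderiv ℝ τ y w)]
  ring

end

end

section

variable {n : ℕ} {M : Type*} [TopologicalSpace M] [ChartedSpace (Euc n) M]

/-! ### Components of tensor fields in charts -/

/-- The value of a `(0,2)`-tensor field on two coordinate vectors. -/
def tensorEval (T : Tensor2 n M) (p : M) (a b : Euc n) : ℝ :=
  T p (show TangentSpace (𝓡 n) p from a) (show TangentSpace (𝓡 n) p from b)

theorem bilin_comp (φ : OpenPartialHomeomorph M (Euc n)) (T : Tensor2 n M) (y a b : Euc n) :
    bilin (comp φ T y) a b = tensorEval T (φ.symm y) (mfderiv (𝓡 n) (𝓡 n) φ.symm y a)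
      (mfderiv (𝓡 n) (𝓡 n) φ.symm y b) := by
  set L : Euc n →L[ℝ] TangentSpace (𝓡 n) (φ.symm y) := mfderiv (𝓡 n) (𝓡 n) φ.symm y with hL
  have h (c : Euc n) : L c = ∑ i, c i • L (EuclideanSpace.single i 1) := by
    conv_lhs => rw [← sum_smul_single c]
    rw [map_sum]; simp only [map_smul]
  change _ = T (φ.symm y) (L a) (L b)
  rw [h a, h b, bilin_apply]
  simp only [map_sum, map_smul, _root_.sum_apply, _root_.smul_apply, smul_eq_mul]
  rw [Finset.sum_comm]
  refine Finset.sum_congr rfl fun k _ => ?_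
  rw [Finset.mul_sum]
  refine Finset.sum_congr rfl fun l _ => ?_
  simp only [comp, coordVector, Matrix.of_apply]
  rw [hL, mul_assoc, mul_comm, mul_assoc]
  exact (mul_left_comm _ _ _)

variable [IsManifold (𝓡 n) ∞ M]

/-- A coordinate field is the tangent map of `φ.symm` composed with a constant section, so its
smoothness follows from that of `φ.symm`. -/
theorem contMDiffOn_coordVector {φ : OpenPartialHomeomorph M (Euc n)} (hφ : φ ∈ smoothCharts n M)
    (e : Euc n) : ContMDiffOn (𝓡 n) ((𝓡 n).prod 𝓘(ℝ, Euc n)) ∞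
      (fun y => TotalSpace.mk' (Euc n) (E := fun x : M => TangentSpace (𝓡 n) x) (φ.symm y)
        (mfderiv (𝓡 n) (𝓡 n) φ.symm y e)) φ.target := by
  have h1 : ContMDiffOn (𝓡 n) (𝓡 n) ∞ φ.symm φ.target := contMDiffOn_symm_of_mem_maximalAtlas hφ
  have h2 := h1.contMDiffOn_tangentMapWithin (m := ∞) le_rfl φ.open_target.uniqueMDiffOn
  have h3 : ContMDiffOn (𝓡 n) ((𝓡 n).prod 𝓘(ℝ, Euc n)) ∞
      (fun y : Euc n => (TotalSpace.mk' (Euc n) (E := fun x : Euc n => TangentSpace (𝓡 n) x) y e))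
      φ.target := by
    exact contMDiffOn_vectorSpace_iff_contDiffOn.2 contDiffOn_const
  refine (h2.comp h3 fun y hy => hy).congr fun y hy => ?_
  simp [tangentMapWithin, mfderivWithin_of_isOpen φ.open_target hy]

theorem contDiffOn_comp {φ : OpenPartialHomeomorph M (Euc n)} (hφ : φ ∈ smoothCharts n M)
    {k : ℕ∞} {T : Tensor2 n M} (hT : T.IsOfClass k) (i j : Fin n) :
    ContDiffOn ℝ k (fun y => comp φ T y i j) φ.target := by
  rw [← contMDiffOn_iff_contDiffOn]
  have h1 : ContMDiffOn (𝓡 n) (𝓡 n) ∞ φ.symm φ.target := contMDiffOn_symm_of_mem_maximalAtlas hφ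
  have hk : (k : ℕ∞ω) ≤ ∞ := by exact_mod_cast le_top
  have h2 := (ContMDiff.contMDiffOn (s := Set.univ) hT).comp (h1.of_le hk) fun y _ => Set.mem_univ _
  have h3 := ContMDiffOn.clm_bundle_apply₂ (F₁ := Euc n) (F₂ := Euc n) (F₃ := ℝ)
    (E₁ := fun x : M => TangentSpace (𝓡 n) x) (E₂ := fun x : M => TangentSpace (𝓡 n) x)
    (E₃ := fun _ : M => ℝ) (ψ := fun y => T (φ.symm y)) (b := fun y => φ.symm y) h2
    ((contMDiffOn_coordVector hφ (EuclideanSpace.single i 1)).of_le hk)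
    ((contMDiffOn_coordVector hφ (EuclideanSpace.single j 1)).of_le hk)
  intro y hy
  have h4 := contMDiffWithinAt_totalSpace.1 (h3 y hy)
  exact h4.2

end

section

variable {n : ℕ}

/-! ### Quadratic changes of coordinates -/

section

variable {E : Type*} [NormedAddCommGroup E] [NormedSpace ℝ E]

/-- The map `y ↦ y₀ + A y + Q(y, y) / 2`. -/
def quadraticMap (y₀ : E) (A : E →L[ℝ] E) (Q : E →L[ℝ] E →L[ℝ] E) (y : E) : E :=
  y₀ + A y + (1 / 2 : ℝ) • Q y y

theorem hasFDerivAt_quadraticMap (y₀ : E) (A : E →L[ℝ] E) {Q : E →L[ℝ] E →L[ℝ] E}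
    (hQ : ∀ a b, Q a b = Q b a) (y : E) :
    HasFDerivAt (quadraticMap y₀ A Q) (A + Q y) y := by
  have h1 : HasFDerivAt (fun y => Q y y) _ y := Q.hasFDerivAt.clm_apply (hasFDerivAt_id y)
  have h2 := (A.hasFDerivAt (x := y)).const_add y₀ |>.add (h1.const_smul (1 / 2 : ℝ))
  refine h2.congr_fderiv ?_
  ext a
  simp only [one_div, _root_.smul_apply, _root_.add_apply, ContinuousLinearMap.coe_id', id_eq,
    ContinuousLinearMap.flip_apply, ContinuousLinearMap.comp_apply, hQ a y, smul_add]
  rw [← add_smul]; norm_num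

theorem fderiv_quadraticMap (y₀ : E) (A : E →L[ℝ] E) {Q : E →L[ℝ] E →L[ℝ] E}
    (hQ : ∀ a b, Q a b = Q b a) : fderiv ℝ (quadraticMap y₀ A Q) = fun y => A + Q y :=
  funext fun y => (hasFDerivAt_quadraticMap y₀ A hQ y).fderiv

theorem fderiv_fderiv_quadraticMap (y₀ : E) (A : E →L[ℝ] E) {Q : E →L[ℝ] E →L[ℝ] E}
    (hQ : ∀ a b, Q a b = Q b a) (y : E) : fderiv ℝ (fderiv ℝ (quadraticMap y₀ A Q)) y = Q := by
  rw [fderiv_quadraticMap y₀ A hQ]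
  exact (Q.hasFDerivAt.const_add A).fderiv

theorem contDiff_quadraticMap (y₀ : E) (A : E →L[ℝ] E) (Q : E →L[ℝ] E →L[ℝ] E) :
    ContDiff ℝ ∞ (quadraticMap y₀ A Q) := by
  unfold quadraticMap
  exact (contDiff_const.add A.contDiff).add ((Q.contDiff.clm_apply contDiff_id).const_smul _)

/-- A smooth map with invertible derivative restricts to a diffeomorphism between open sets. -/
theorem exists_openPartialHomeomorph [CompleteSpace E] {τ : E → E} (hτ : ContDiff ℝ ∞ τ) {y : E}
    {A : E ≃L[ℝ] E} (hA : HasFDerivAt τ (A : E →L[ℝ] E) y) {s : Set E} (hs : IsOpen s)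
    (hy : y ∈ s) :
    ∃ e : OpenPartialHomeomorph E E, y ∈ e.source ∧ e.source ⊆ s ∧ (∀ z, e z = τ z) ∧
      ContDiffOn ℝ ∞ e.symm e.target := by
  let e₀ := hτ.contDiffAt.toOpenPartialHomeomorph τ hA (by simp)
  -- The source is shrunk to points where the derivative is invertible, so that the inverse is
  -- smooth on the whole target and not only at the image of `y`.
  let t : Set E := s ∩ fderiv ℝ τ ⁻¹' Set.range ((↑) : (E ≃L[ℝ] E) → E →L[ℝ] E)
  have ht : IsOpen t := hs.inter
    (ContinuousLinearEquiv.isOpen.preimage (hτ.continuous_fderiv (by simp)))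
  have hyt : y ∈ t := ⟨hy, A, hA.fderiv.symm⟩
  have hcoe (z : E) : (e₀.restrOpen t ht) z = τ z := rfl
  refine ⟨e₀.restrOpen t ht, ⟨hτ.contDiffAt.mem_toOpenPartialHomeomorph_source hA (by simp), hyt⟩,
    fun z hz => hz.2.1, hcoe, fun w hw => ?_⟩
  have hz := (e₀.restrOpen t ht).map_target hw
  obtain ⟨A', hA'⟩ := hz.2.2
  refine ((e₀.restrOpen t ht).contDiffAt_symm (f₀' := A') hw ?_ hτ.contDiffAt).contDiffWithinAt
  rw [hA']
  exact (hτ.differentiable (by simp) _).hasFDerivAt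

end

/-- A positive definite bilinear form has an orthonormal frame. -/
theorem exists_orthonormal_frame {A : Matrix (Fin n) (Fin n) ℝ} (hA : A.PosDef) :
    ∃ S : Euc n ≃L[ℝ] Euc n, ∀ a b, bilin A (S a) (S b) = ∑ i, a i * b i := by
  obtain ⟨B, hB⟩ := exists_factor hA.posSemidef
  let L : Euc n →ₗ[ℝ] Euc n := Matrix.toEuclideanLin B
  have hL (a : Euc n) (i : Fin n) : L a i = ∑ j, B i j * a j := rfl
  have h (a b : Euc n) : bilin A a b = ∑ i, L a i * L b i := by
    simp only [bilin_apply, hL, hB, Matrix.mul_apply, Matrix.transpose_apply, Finset.sum_mul,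
      Finset.mul_sum]
    rw [Finset.sum_congr rfl fun j _ => Finset.sum_comm, Finset.sum_comm]
    refine Finset.sum_congr rfl fun i _ => ?_
    rw [Finset.sum_comm]
    exact Finset.sum_congr rfl fun j _ => Finset.sum_congr rfl fun k _ => by ring
  have hinj : Function.Injective L := by
    rw [← LinearMap.ker_eq_bot, LinearMap.ker_eq_bot']
    intro a ha
    by_contra hne
    have h1 := hA.quadForm_pos (v := a) fun h0 => hne (by ext i; exact congr_fun h0 i)
    rw [← bilin_self, h, ha] at h1
    simp at h1
  let e : Euc n ≃L[ℝ] Euc n := (LinearEquiv.ofInjectiveEndo L hinj).toContinuousLinearEquiv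
  refine ⟨e.symm, fun a b => ?_⟩
  rw [h]
  have h2 (a : Euc n) : L (e.symm a) = a := e.apply_symm_apply a
  rw [h2, h2]

/-- The bilinear map with prescribed values on the standard basis. -/
def bilinOfBasis (q : Fin n → Fin n → Euc n) : Euc n →L[ℝ] Euc n →L[ℝ] Euc n :=
  ∑ i, ∑ j, (EuclideanSpace.proj i : Euc n →L[ℝ] ℝ).smulRight
    ((EuclideanSpace.proj j : Euc n →L[ℝ] ℝ).smulRight (q i j))

theorem bilinOfBasis_apply (q : Fin n → Fin n → Euc n) (a b : Euc n) :
    bilinOfBasis q a b = ∑ i, ∑ j, (a i * b j) • q i j := by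
  simp [bilinOfBasis, smul_smul]

variable {G : Euc n → Matrix (Fin n) (Fin n) ℝ} {U : Set (Euc n)} {x : Euc n}

/-- Existence of coordinates that are normal at a point. -/
theorem IsMetricOn.exists_quadraticMap (hG : IsMetricOn G U) (hx : x ∈ U) :
    ∃ (S : Euc n ≃L[ℝ] Euc n) (Q : Euc n →L[ℝ] Euc n →L[ℝ] Euc n), (∀ a b, Q a b = Q b a) ∧
      ∀ G' : Euc n → Matrix (Fin n) (Fin n) ℝ,
        (∀ᶠ z in 𝓝 0, ∀ a b, bilin (G' z) a b = bilin (G (quadraticMap x S Q z))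
          (fderiv ℝ (quadraticMap x S Q) z a) (fderiv ℝ (quadraticMap x S Q) z b)) →
        IsNormalAt G' 0 := by
  obtain ⟨S, hS⟩ := exists_orthonormal_frame (hG.posDef x hx)
  have d := differentiableAt_bilin
    fun a b => (hG.smooth a b).differentiableAt_of_isOpen hG.isOpen hx
  set D : Euc n → Euc n → Euc n → ℝ := fun a b c =>
    fderiv ℝ (fun y => bilin (G y)) x (S a) (S b) (S c) with hD
  have hDsymm (a b c : Euc n) : D a b c = D a c b := by
    simp only [hD]
    rw [← fderiv_bilinear_apply d, ← fderiv_bilinear_apply d]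
    have : (fun z => bilin (G z) (S b) (S c)) =ᶠ[𝓝 x] fun z => bilin (G z) (S c) (S b) := by
      filter_upwards [hG.isOpen.mem_nhds hx] with y hy
        using bilin_comm (fun i j => hG.symm hy i j) _ _
    rw [this.fderiv_eq]
  let e : Fin n → Euc n := fun i => EuclideanSpace.single i 1
  -- `t` is the Christoffel symbol of the first kind in the orthonormal frame `S e_k`. The second
  -- derivative of the coordinate change is minus the corresponding symbol of the second kind, so
  -- that it cancels the first derivatives of the metric.
  let t : Fin n → Fin n → Fin n → ℝ := fun i j k =>
    (1 / 2) * (D (e i) (e j) (e k) + D (e j) (e i) (e k) - D (e k) (e i) (e j))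
  let q : Fin n → Fin n → Euc n := fun i j => -∑ k, t i j k • S (e k)
  have hq (i j : Fin n) : q i j = q j i := by
    simp only [q, t]
    refine congrArg _ (Finset.sum_congr rfl fun k _ => ?_)
    rw [hDsymm (e k) (e j) (e i)]
    congr 1; ring
  have hQ (a b : Euc n) : bilinOfBasis q a b = bilinOfBasis q b a := by
    rw [bilinOfBasis_apply, bilinOfBasis_apply, Finset.sum_comm]
    exact Finset.sum_congr rfl fun i _ => Finset.sum_congr rfl fun j _ => by rw [hq, mul_comm]
  have hQe (i j : Fin n) : bilinOfBasis q (e i) (e j) = q i j := by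
    rw [bilinOfBasis_apply, Finset.sum_eq_single i, Finset.sum_eq_single j]
    · simp [e]
    · intro k _ hk; simp [e, hk]
    · simp
    · intro k _ hk; simp [e, hk]
    · simp
  have hGq (i j k : Fin n) : bilin (G x) (q i j) (S (e k)) = -t i j k := by
    simp only [q, map_neg, map_sum, map_smul, _root_.neg_apply, _root_.sum_apply, _root_.smul_apply,
      hS, smul_eq_mul]
    simp [e]
  refine ⟨S, bilinOfBasis q, hQ, fun G' hG' => ?_⟩
  have hτ0 : quadraticMap x (S : Euc n →L[ℝ] Euc n) (bilinOfBasis q) 0 = x := by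
    simp [quadraticMap]
  have hdτ0 : fderiv ℝ (quadraticMap x (S : Euc n →L[ℝ] Euc n) (bilinOfBasis q)) 0 = S := by
    rw [fderiv_quadraticMap _ _ hQ]; simp
  constructor
  · ext i j
    rw [← bilin_single (G' 0), hG'.self_of_nhds, hdτ0, hτ0]
    refine (hS _ _).trans ?_
    simp [Matrix.one_apply, eq_comm]
  · intro i j k
    have h1 : (fun z => G' z j k) =ᶠ[𝓝 0] fun z =>
        bilin (G (quadraticMap x (S : Euc n →L[ℝ] Euc n) (bilinOfBasis q) z))
          (fderiv ℝ (quadraticMap x (S : Euc n →L[ℝ] Euc n) (bilinOfBasis q)) z (e j))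
          (fderiv ℝ (quadraticMap x (S : Euc n →L[ℝ] Euc n) (bilinOfBasis q)) z (e k)) := by
      filter_upwards [hG'] with z hz
      rw [← hz, bilin_single]
    have h2 := fderiv_pullback (B := fun z => bilin (G z))
      (τ := quadraticMap x (S : Euc n →L[ℝ] Euc n) (bilinOfBasis q)) (y := 0) (by rwa [hτ0])
      ((contDiff_quadraticMap _ _ _).contDiffAt.of_le ENat.LEInfty.out) (e j) (e k) (e i)
    rw [pd_congr h1, pd]
    refine h2.trans ?_
    rw [fderiv_fderiv_quadraticMap _ _ hQ, hdτ0, hτ0, hQe, hQe]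
    have h3 := bilin_comm (fun i j => hG.symm hx i j) (S (e j)) (q i k)
    have h4 : fderiv ℝ (fun y => bilin (G y)) x (S (e i)) (S (e j)) (S (e k)) =
      D (e i) (e j) (e k) := rfl
    have h5 := hGq i j k
    have h6 := hGq i k j
    simp only [t] at h5 h6
    rw [hDsymm (e j) (e i) (e k), hDsymm (e i) (e j) (e k)] at h5
    rw [hDsymm (e k) (e i) (e j), hDsymm (e j) (e i) (e k)] at h6
    rw [hDsymm (e k) (e i) (e j)] at h5
    rw [hDsymm (e i) (e j) (e k)] at h4
    simp only [ContinuousLinearEquiv.coe_coe] at *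
    -- The cancellation is `t i j k + t i k j = D_i g_jk`, i.e. metric compatibility.
    rw [h3, h4, h5, h6]
    ring

end

section

variable {n : ℕ} {M : Type*} [TopologicalSpace M]

/-! ### Smooth charts and changes of charts -/

variable {φ φ' : OpenPartialHomeomorph M (Euc n)}

theorem eventually_transition {y : Euc n} (hy : y ∈ φ'.target) (hy' : φ'.symm y ∈ φ.source) :
    ∀ᶠ z in 𝓝 y, z ∈ φ'.target ∧ φ'.symm z ∈ φ.source :=
  Filter.Eventually.and (φ'.open_target.mem_nhds hy)
    ((φ'.continuousAt_symm hy).preimage_mem_nhds (φ.open_source.mem_nhds hy'))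

theorem comp_symm_transition {f : M → ℝ} {y : Euc n} (hy : y ∈ φ'.target)
    (hy' : φ'.symm y ∈ φ.source) : f ∘ φ'.symm =ᶠ[𝓝 y] (f ∘ φ.symm) ∘ (φ ∘ φ'.symm) := by
  filter_upwards [eventually_transition hy hy'] with z hz
  simp [φ.left_inv hz.2]

variable [ChartedSpace (Euc n) M]

theorem mdifferentiable_of_mem_smoothCharts (hφ : φ ∈ smoothCharts n M) :
    φ.MDifferentiable (𝓡 n) (𝓡 n) :=
  ⟨(contMDiffOn_of_mem_maximalAtlas hφ).mdifferentiableOn (by simp),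
    (contMDiffOn_symm_of_mem_maximalAtlas hφ).mdifferentiableOn (by simp)⟩

theorem contDiffOn_comp_symm {f : M → ℝ} (hf : ContMDiff (𝓡 n) 𝓘(ℝ, ℝ) ∞ f)
    (hφ : φ ∈ smoothCharts n M) : ContDiffOn ℝ ∞ (f ∘ φ.symm) φ.target := by
  rw [← contMDiffOn_iff_contDiffOn]
  exact hf.comp_contMDiffOn (contMDiffOn_symm_of_mem_maximalAtlas hφ)

theorem contDiffAt_transition (hφ : φ ∈ smoothCharts n M) (hφ' : φ' ∈ smoothCharts n M)
    {y : Euc n} (hy : y ∈ φ'.target) (hy' : φ'.symm y ∈ φ.source) :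
    ContDiffAt ℝ ∞ (φ ∘ φ'.symm) y := by
  rw [← contMDiffAt_iff_contDiffAt]
  exact (contMDiffAt_of_mem_maximalAtlas hφ hy').comp y (contMDiffAt_symm_of_mem_maximalAtlas hφ' hy)

theorem surjective_fderiv_transition (hφ : φ ∈ smoothCharts n M) (hφ' : φ' ∈ smoothCharts n M)
    {y : Euc n} (hy : y ∈ φ'.target) (hy' : φ'.symm y ∈ φ.source) :
    Function.Surjective (fderiv ℝ (φ ∘ φ'.symm) y) := by
  have hz := φ.map_source hy'
  have hz' : φ.symm (φ (φ'.symm y)) ∈ φ'.source := by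
    rw [φ.left_inv hy']; exact φ'.map_target hy
  have hzy : (φ' ∘ φ.symm) (φ (φ'.symm y)) = y := by
    simp [φ.left_inv hy', φ'.right_inv hy]
  have h1 := ((contDiffAt_transition hφ hφ' hy hy').differentiableAt (by simp)).hasFDerivAt
  have h2 := ((contDiffAt_transition hφ' hφ hz hz').differentiableAt (by simp)).hasFDerivAt
  have h3 : (φ ∘ φ'.symm) ∘ (φ' ∘ φ.symm) =ᶠ[𝓝 (φ (φ'.symm y))] id := by
    filter_upwards [eventually_transition hz hz'] with w hw
    simp [φ'.left_inv hw.2, φ.right_inv hw.1]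
  rw [← hzy] at h1
  have h4 := (h1.comp _ h2).unique ((hasFDerivAt_id _).congr_of_eventuallyEq h3)
  rw [hzy] at h4
  intro a
  exact ⟨_, DFunLike.congr_fun h4 a⟩

theorem bilin_comp_transition (hφ : φ ∈ smoothCharts n M) (hφ' : φ' ∈ smoothCharts n M)
    {y : Euc n} (hy : y ∈ φ'.target) (hy' : φ'.symm y ∈ φ.source) (T : Tensor2 n M) (a b : Euc n) :
    bilin (comp φ' T y) a b = bilin (comp φ T ((φ ∘ φ'.symm) y))
      (fderiv ℝ (φ ∘ φ'.symm) y a) (fderiv ℝ (φ ∘ φ'.symm) y b) := by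
  have hτ := (contDiffAt_transition hφ hφ' hy hy').differentiableAt (by simp)
  have h1 : φ'.symm =ᶠ[𝓝 y] φ.symm ∘ (φ ∘ φ'.symm) := by
    filter_upwards [eventually_transition hy hy'] with z hz
    simp [φ.left_inv hz.2]
  have h2 : mfderiv (𝓡 n) (𝓡 n) (φ.symm ∘ (φ ∘ φ'.symm)) y =
      (mfderiv (𝓡 n) (𝓡 n) φ.symm ((φ ∘ φ'.symm) y)).comp
        (mfderiv (𝓡 n) (𝓡 n) (φ ∘ φ'.symm) y) :=
    mfderiv_comp y ((mdifferentiable_of_mem_smoothCharts hφ).mdifferentiableAt_symm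
      (φ.map_source hy')) hτ.mdifferentiableAt
  have h3 (c : Euc n) : (mfderiv (𝓡 n) (𝓡 n) φ'.symm y c : Euc n) =
      mfderiv (𝓡 n) (𝓡 n) φ.symm ((φ ∘ φ'.symm) y) (fderiv ℝ (φ ∘ φ'.symm) y c) := by
    rw [← mfderiv_eq_fderiv]
    have h4 := h1.mfderiv_eq (I := 𝓡 n) (I' := 𝓡 n)
    exact (DFunLike.congr_fun h4 c).trans (DFunLike.congr_fun h2 c)
  rw [bilin_comp, bilin_comp]
  have h5 : φ.symm ((φ ∘ φ'.symm) y) = φ'.symm y := (h1.self_of_nhds).symm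
  -- The base points `φ.symm (τ y)` and `φ'.symm y` are equal only propositionally, and so are the
  -- tangent spaces there. Treating vectors as elements of `Euc n` and generalizing the point makes
  -- `subst` possible.
  have key (p : M) (hp : p = φ'.symm y) (a' b' a'' b'' : Euc n) (ha : a' = a'') (hb : b' = b'') :
      tensorEval T (φ'.symm y) a' b' = tensorEval T p a'' b'' := by
    subst hp ha hb; rfl
  exact key _ h5 _ _ _ _ (h3 a) (h3 b)

variable [IsManifold (𝓡 n) ∞ M]

theorem chartAt_mem_smoothCharts (x : M) : chartAt (Euc n) x ∈ smoothCharts n M :=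
  IsManifold.chart_mem_maximalAtlas x

theorem isMetricOn_comp (g : Metric n M) (hφ : φ ∈ smoothCharts n M) :
    IsMetricOn (comp φ g.inner) φ.target where
  isOpen := φ.open_target
  smooth a b := contDiffOn_comp hφ (k := ⊤) g.contMDiff a b
  posDef y hy := by
    have hsymm (i j : Fin n) : comp φ g.inner y i j = comp φ g.inner y j i := g.symm _ _ _
    refine Matrix.PosDef.of_dotProduct_mulVec_pos (by ext i j; exact hsymm j i) fun v hv => ?_
    have h1 : (mfderiv (𝓡 n) (𝓡 n) φ.symm y (WithLp.toLp 2 v : Euc n)) ≠ 0 := by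
      intro h0
      refine hv ?_
      have h2 := (mdifferentiable_of_mem_smoothCharts hφ).symm.mfderiv_injective hy
        (h0.trans (map_zero _).symm)
      exact congrArg WithLp.ofLp h2
    have h3 := bilin_comp φ g.inner y (WithLp.toLp 2 v) (WithLp.toLp 2 v)
    rw [bilin_self, quadForm_eq] at h3
    have h4 := g.pos (φ.symm y) _ h1
    simpa using h4.trans_eq h3.symm

/-- Existence of charts that are normal at a given point. -/
theorem exists_normal_chart (g : Metric n M) (p : M) :
    ∃ φ ∈ smoothCharts n M, p ∈ φ.source ∧ IsNormalAt (comp φ g.inner) (φ p) := by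
  set φ := chartAt (Euc n) p with hφdef
  have hφ : φ ∈ smoothCharts n M := chartAt_mem_smoothCharts p
  have hp : p ∈ φ.source := mem_chart_source _ p
  obtain ⟨S, Q, hQ, hN⟩ := (isMetricOn_comp g hφ).exists_quadraticMap (φ.map_source hp)
  set τ := quadraticMap (φ p) (S : Euc n →L[ℝ] Euc n) Q with hτdef
  have hτ : ContDiff ℝ ∞ τ := contDiff_quadraticMap _ _ _
  have hτ0 : τ 0 = φ p := by simp [hτdef, quadraticMap]
  have hA : HasFDerivAt τ (S : Euc n →L[ℝ] Euc n) 0 := by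
    simpa using hasFDerivAt_quadraticMap (φ p) (S : Euc n →L[ℝ] Euc n) hQ 0
  obtain ⟨e, he0, hes, heτ, hsymm⟩ := exists_openPartialHomeomorph hτ hA
    (hτ.continuous.isOpen_preimage _ φ.open_target)
    (show (0 : Euc n) ∈ τ ⁻¹' φ.target by rw [Set.mem_preimage, hτ0]; exact φ.map_source hp)
  have hep : e.symm (φ p) = 0 := by rw [← hτ0, ← heτ, e.left_inv he0]
  have hpt : φ p ∈ e.target := by rw [← hτ0, ← heτ]; exact e.map_source he0
  -- The new coordinates `z` satisfy `φ = τ(z)`, hence the composition with the inverse of the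
  -- quadratic map.
  set φ' := φ.trans e.symm with hφ'def
  have hφ' : φ' ∈ smoothCharts n M := by
    refine φ'.mem_maximalAtlas_of_contMDiffOn ?_ ?_
    · refine (contMDiffOn_iff_contDiffOn.2 hsymm).comp
        ((contMDiffOn_of_mem_maximalAtlas hφ).mono fun x hx => hx.1) fun x hx => hx.2
    · refine (contMDiffOn_symm_of_mem_maximalAtlas hφ).comp
        ((contMDiffOn_iff_contDiffOn.2 hτ.contDiffOn).congr fun z _ => heτ z) fun z hz => hz.2
  have hpφ' : p ∈ φ'.source := ⟨hp, hpt⟩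
  refine ⟨φ', hφ', hpφ', ?_⟩
  have h0 : φ' p = 0 := hep
  rw [h0]
  have h0t : (0 : Euc n) ∈ φ'.target := h0 ▸ φ'.map_source hpφ'
  have h0s : φ'.symm 0 ∈ φ.source := by rw [← h0, φ'.left_inv hpφ']; exact hp
  have hev : φ ∘ φ'.symm =ᶠ[𝓝 0] τ := by
    filter_upwards [e.open_source.mem_nhds he0] with z hz
    have : τ z ∈ φ.target := hes hz
    have h1 : φ'.symm z = φ.symm (e z) := rfl
    rw [Function.comp_apply, h1, heτ, φ.right_inv this]
  refine hN _ ?_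
  filter_upwards [eventually_transition h0t h0s, hev.eventuallyEq_nhds] with z hz hz' a b
  rw [bilin_comp_transition hφ hφ' hz.1 hz.2, hz'.fderiv_eq, hz'.self_of_nhds]

end

section

variable {n : ℕ} {G T : Euc n → Matrix (Fin n) (Fin n) ℝ} {x : Euc n}

/-! ### Consequences of positive sectional curvature -/

theorem riemann_antisymm (G : Euc n → Matrix (Fin n) (Fin n) ℝ) (i j k l : Fin n) (x : Euc n) :
    riemann G i j k l x = -riemann G j i k l x := by
  simp only [riemann, ← Finset.sum_neg_distrib]
  refine Finset.sum_congr rfl fun m _ => ?_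
  rw [← mul_neg, neg_add, neg_sub, ← Finset.sum_neg_distrib]
  simp only [neg_sub]

/-- The quadrilinear form `R(v, w, v, w)`. -/
def curvForm (G : Euc n → Matrix (Fin n) (Fin n) ℝ) (x : Euc n) (v w : Fin n → ℝ) : ℝ :=
  ∑ j, ∑ l, (∑ a, ∑ b, riemann G a j b l x * v a * v b) * w j * w l

theorem curvForm_eq (G : Euc n → Matrix (Fin n) (Fin n) ℝ) (x : Euc n) (v w : Fin n → ℝ) :
    curvForm G x v w = ∑ i, ∑ j, ∑ k, ∑ l, riemann G i j k l x * v i * w j * v k * w l := by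
  simp only [curvForm, Finset.sum_mul]
  rw [Finset.sum_congr rfl fun j _ => Finset.sum_comm, Finset.sum_comm]
  refine Finset.sum_congr rfl fun i _ => Finset.sum_congr rfl fun j _ => ?_
  rw [Finset.sum_comm]
  exact Finset.sum_congr rfl fun k _ => Finset.sum_congr rfl fun l _ => by ring

theorem curvForm_smul_right (G : Euc n → Matrix (Fin n) (Fin n) ℝ) (x : Euc n) (v w : Fin n → ℝ)
    (c : ℝ) : curvForm G x v (c • w) = c ^ 2 * curvForm G x v w := by
  simp only [curvForm, Finset.mul_sum, Pi.smul_apply, smul_eq_mul]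
  exact Finset.sum_congr rfl fun j _ => Finset.sum_congr rfl fun l _ => by ring

theorem curvForm_self (G : Euc n → Matrix (Fin n) (Fin n) ℝ) (x : Euc n) (v : Fin n → ℝ) :
    curvForm G x v v = 0 := by
  have h : curvForm G x v v = -curvForm G x v v := by
    conv_lhs => rw [curvForm_eq, Finset.sum_comm]
    rw [curvForm_eq, ← Finset.sum_neg_distrib]
    refine Finset.sum_congr rfl fun i _ => ?_
    rw [← Finset.sum_neg_distrib]
    refine Finset.sum_congr rfl fun j _ => ?_
    rw [← Finset.sum_neg_distrib]
    refine Finset.sum_congr rfl fun k _ => ?_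
    rw [← Finset.sum_neg_distrib]
    refine Finset.sum_congr rfl fun l _ => ?_
    rw [riemann_antisymm]; ring
  linarith

/-- By Cauchy–Schwarz the denominator of the sectional curvature is nonnegative, so a positive
quotient has a positive numerator. A zero denominator is excluded as well, as the quotient would
then be `0`. -/
theorem IsNormalAt.curvForm_pos (hN : IsNormalAt G x) {v w : Fin n → ℝ}
    (h : 0 < sectional G v w x) : 0 < curvForm G x v w := by
  rw [sectional, ← curvForm_eq] at h
  have hD : 0 ≤ (∑ i, ∑ j, G x i j * v i * v j) * (∑ i, ∑ j, G x i j * w i * w j) -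
      (∑ i, ∑ j, G x i j * v i * w j) ^ 2 := by
    have := Finset.sum_mul_sq_le_sq_mul_sq Finset.univ v w
    simp only [hN.apply, ite_mul, one_mul, zero_mul, Finset.sum_ite_eq, Finset.mem_univ, if_true]
    simp only [← pow_two]
    linarith
  by_contra hc
  exact absurd h (not_lt.2 (div_nonpos_of_nonpos_of_nonneg (not_lt.1 hc) hD))

/-- Only dependent pairs are left open by the hypothesis, and on those the form vanishes by
antisymmetry. -/
theorem IsNormalAt.curvForm_nonneg (hN : IsNormalAt G x)
    (h : ∀ v w : Fin n → ℝ, LinearIndependent ℝ ![v, w] → 0 < sectional G v w x)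
    (v w : Fin n → ℝ) : 0 ≤ curvForm G x v w := by
  by_cases hv : v = 0
  · simp [curvForm, hv]
  by_cases hw : LinearIndependent ℝ ![v, w]
  · exact (hN.curvForm_pos (h v w hw)).le
  · rw [LinearIndependent.pair_iff' hv] at hw
    push Not at hw
    obtain ⟨c, rfl⟩ := hw
    rw [curvForm_smul_right, curvForm_self, mul_zero]

/-- In normal coordinates `Ric(v, v) = ∑ j, R(v, e_j, v, e_j)` has nonnegative terms. If `v i ≠ 0`,
any `j ≠ i` gives an `e_j` independent of `v`, hence a positive term; this needs `n ≥ 2`. -/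
theorem IsNormalAt.ricci_pos (hn : 2 ≤ n) (hN : IsNormalAt G x)
    (h : ∀ v w : Fin n → ℝ, LinearIndependent ℝ ![v, w] → 0 < sectional G v w x)
    {v : Fin n → ℝ} (hv : v ≠ 0) : 0 < ∑ a, ∑ b, ricci G a b x * v a * v b := by
  have h0 (j : Fin n) : curvForm G x v (Pi.single j 1) =
      ∑ a, ∑ b, riemann G a j b j x * v a * v b := by
    rw [curvForm, Finset.sum_eq_single j, Finset.sum_eq_single j]
    · simp
    · intro k _ hk; simp [hk]
    · simp
    · intro k _ hk; simp [hk]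
    · simp
  have h1 : ∑ a, ∑ b, ricci G a b x * v a * v b = ∑ j, curvForm G x v (Pi.single j 1) := by
    simp only [h0, hN.ricci_eq, Finset.sum_mul]
    rw [Finset.sum_congr rfl fun a _ => Finset.sum_comm, Finset.sum_comm]
  rw [h1]
  obtain ⟨i, hi⟩ := Function.ne_iff.1 hv
  rw [Pi.zero_apply] at hi
  have : Nontrivial (Fin n) := Fin.nontrivial_iff_two_le.2 hn
  obtain ⟨j, hj⟩ := exists_ne i
  refine Finset.sum_pos' (fun k _ => hN.curvForm_nonneg h _ _) ⟨j, Finset.mem_univ _, ?_⟩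
  refine hN.curvForm_pos (h _ _ ((LinearIndependent.pair_iff' hv).2 fun c hc => ?_))
  have h2 := congr_fun hc i
  have h3 := congr_fun hc j
  have hc0 : c = 0 := by simpa [hj.symm, hi] using h2
  simp [hc0] at h3

/-! ### Comparison of quadratic forms -/

/-- The maximum of `A(v, v) / B(v, v)` over all directions `v`. -/
def maxRatio (A B : Matrix (Fin n) (Fin n) ℝ) : ℝ :=
  sSup ((fun v : _root_.Metric.sphere (0 : Euc n) 1 =>
    quadForm A v.1 / quadForm B v.1) '' Set.univ)

theorem ofLp_ne_zero {v : Euc n} (hv : v ≠ 0) : (v : Fin n → ℝ) ≠ 0 := fun h =>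
  hv (congrArg (WithLp.toLp 2) h)

theorem ne_zero_of_mem_unitSphere {v : Euc n} (hv : v ∈ _root_.Metric.sphere (0 : Euc n) 1) :
    v ≠ 0 :=
  ne_zero_of_mem_unit_sphere ⟨v, hv⟩

theorem continuous_quadForm {X : Type*} [TopologicalSpace X] {A : X → Matrix (Fin n) (Fin n) ℝ}
    {v : X → Euc n} (hA : ∀ i j, Continuous fun x => A x i j) (hv : Continuous v) :
    Continuous fun x => quadForm (A x) (v x) := by
  unfold quadForm
  fun_prop

theorem continuous_maxRatio {X : Type*} [TopologicalSpace X] {A B : X → Matrix (Fin n) (Fin n) ℝ}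
    (hA : ∀ i j, Continuous fun x => A x i j) (hB : ∀ i j, Continuous fun x => B x i j)
    (hpos : ∀ x, ∀ v : Fin n → ℝ, v ≠ 0 → 0 < quadForm (B x) v) :
    Continuous fun x => maxRatio (A x) (B x) := by
  refine isCompact_univ.continuous_sSup (f := fun x (v : _root_.Metric.sphere (0 : Euc n) 1) =>
    quadForm (A x) v.1 / quadForm (B x) v.1) ?_
  refine Continuous.div
    (continuous_quadForm (fun i j => (hA i j).comp continuous_fst)
      (continuous_subtype_val.comp continuous_snd))
    (continuous_quadForm (fun i j => (hB i j).comp continuous_fst)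
      (continuous_subtype_val.comp continuous_snd)) ?_
  rintro ⟨x, v, hv⟩
  exact (hpos x _ (ofLp_ne_zero (ne_zero_of_mem_unitSphere hv))).ne'

section

variable {A B : Matrix (Fin n) (Fin n) ℝ}

/-- The supremum over the compact unit sphere is attained, and homogeneity of degree two extends the
bound to all vectors. -/
theorem maxRatio_spec (hn : 0 < n) (hB : ∀ v : Fin n → ℝ, v ≠ 0 → 0 < quadForm B v) :
    (∀ v : Fin n → ℝ, quadForm A v ≤ maxRatio A B * quadForm B v) ∧
      ∃ v : Euc n, v ≠ 0 ∧ quadForm A v = maxRatio A B * quadForm B v := by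
  have : Nonempty (_root_.Metric.sphere (0 : Euc n) 1) :=
    ⟨EuclideanSpace.single ⟨0, hn⟩ 1, by simp⟩
  have hq (C : Matrix (Fin n) (Fin n) ℝ) :
      Continuous fun v : _root_.Metric.sphere (0 : Euc n) 1 => quadForm C v.1 :=
    continuous_quadForm (A := fun _ => C) (fun _ _ => continuous_const) continuous_subtype_val
  have hc : Continuous fun v : _root_.Metric.sphere (0 : Euc n) 1 =>
      quadForm A v.1 / quadForm B v.1 :=
    (hq A).div (hq B) fun v => (hB _ (ofLp_ne_zero (ne_zero_of_mem_unitSphere v.2))).ne'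
  obtain ⟨w, -, hw, hmax⟩ := isCompact_univ.exists_sSup_image_eq_and_ge Set.univ_nonempty
    hc.continuousOn
  refine ⟨fun v => ?_, w.1, ne_zero_of_mem_unitSphere w.2, ?_⟩
  · by_cases hv : v = 0
    · simp [hv, quadForm]
    obtain ⟨v', rfl⟩ : ∃ v' : Euc n, v = v' := ⟨WithLp.toLp 2 v, rfl⟩
    have hv0 : v' ≠ 0 := fun h => hv (by rw [h]; rfl)
    have hnorm : ‖v'‖ ≠ 0 := norm_ne_zero_iff.2 hv0
    have h1 := hmax ⟨‖v'‖⁻¹ • v', by simp [norm_smul, hnorm]⟩ (Set.mem_univ _)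
    rw [← hw] at h1
    have h2 (C : Matrix (Fin n) (Fin n) ℝ) :
        quadForm C (‖v'‖⁻¹ • v' : Euc n) = ‖v'‖⁻¹ ^ 2 * quadForm C v' :=
      quadForm_smul_right C _ v'
    rw [h2, h2, mul_div_mul_left _ _ (by positivity)] at h1
    exact (div_le_iff₀ (hB _ (ofLp_ne_zero hv0))).1 h1
  · exact (div_eq_iff (hB _ (ofLp_ne_zero (ne_zero_of_mem_unitSphere w.2))).ne').1 hw.symm

theorem le_of_maxRatio {c : ℝ} (hn : 0 < n) (hB : ∀ v : Fin n → ℝ, v ≠ 0 → 0 < quadForm B v)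
    (h : ∀ v : Fin n → ℝ, quadForm A v ≤ c * quadForm B v) : maxRatio A B ≤ c := by
  obtain ⟨-, v, hv, hv'⟩ := maxRatio_spec (A := A) hn hB
  have h1 := h v
  rw [hv'] at h1
  exact le_of_mul_le_mul_right h1 (hB v (ofLp_ne_zero hv))

/-- A change of basis does not preserve the unit sphere, so the two suprema are compared through the
inequality `A ≤ c B` for all vectors, of which each supremum is the best constant. -/
theorem maxRatio_congr {A' B' : Matrix (Fin n) (Fin n) ℝ} (hn : 0 < n)
    (hB : ∀ v : Fin n → ℝ, v ≠ 0 → 0 < quadForm B v)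
    (hB' : ∀ v : Fin n → ℝ, v ≠ 0 → 0 < quadForm B' v) {S : Euc n →L[ℝ] Euc n}
    (hS : Function.Surjective S) (hA : ∀ v : Euc n, quadForm A' v = quadForm A (S v))
    (hBB : ∀ v : Euc n, quadForm B' v = quadForm B (S v)) : maxRatio A' B' = maxRatio A B := by
  refine le_antisymm (le_of_maxRatio hn hB' fun v => ?_) (le_of_maxRatio hn hB fun v => ?_)
  · have h1 := hA (WithLp.toLp 2 v)
    have h2 := hBB (WithLp.toLp 2 v)
    simp only at h1 h2
    rw [h1, h2]
    exact (maxRatio_spec hn hB).1 _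
  · obtain ⟨w, hw⟩ := hS (WithLp.toLp 2 v)
    have h1 := hA w
    have h2 := hBB w
    rw [hw] at h1 h2
    simp only at h1 h2
    rw [← h1, ← h2]
    exact (maxRatio_spec hn hB').1 _

/-- `|T(v, v)| ≤ |T| |v|²`. -/
theorem quadForm_le_sqrt_normSq₂ (hA : A.PosDef) (T : Matrix (Fin n) (Fin n) ℝ) (v : Fin n → ℝ) :
    quadForm T v ≤ √(normSq₂ A T) * quadForm A v := by
  obtain ⟨B, hB⟩ := exists_factor hA.posSemidef
  have hdet : IsUnit B.det := by
    have := hA.det_pos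
    rw [hB, Matrix.det_mul, Matrix.det_transpose] at this
    exact isUnit_iff_ne_zero.2 fun h0 => by simp [h0] at this
  have hinv : A⁻¹ = B⁻¹ * B⁻¹.transpose := by
    rw [hB, Matrix.mul_inv_rev, Matrix.transpose_nonsing_inv]
  set C := B⁻¹ with hC
  set w := B.mulVec v with hw
  have hv : v = C.mulVec w := by
    rw [hw, Matrix.mulVec_mulVec, Matrix.nonsing_inv_mul _ hdet, Matrix.one_mulVec]
  have h1 : quadForm A v = ∑ i, w i ^ 2 := by
    rw [quadForm_eq, hB, ← Matrix.mulVec_mulVec, Matrix.dotProduct_mulVec, Matrix.vecMul_transpose]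
    simp [dotProduct, pow_two, hw]
  -- `S` is the matrix of the tensor in an orthonormal frame for `A`. There the norm is the
  -- Frobenius norm and the claim is Cauchy–Schwarz for sums over pairs of indices.
  set S : Matrix (Fin n) (Fin n) ℝ := C.transpose * T * C with hS
  have h2 : quadForm T v = ∑ p : Fin n × Fin n, S p.1 p.2 * (w p.1 * w p.2) := by
    have : quadForm T v = quadForm S w := by
      rw [quadForm_eq, quadForm_eq, hS, ← Matrix.mulVec_mulVec, ← hv, ← Matrix.mulVec_mulVec,
        Matrix.dotProduct_mulVec w, Matrix.vecMul_transpose, ← hv]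
    rw [this, quadForm, Fintype.sum_prod_type]
    exact Finset.sum_congr rfl fun i _ => Finset.sum_congr rfl fun j _ => by ring
  have h3 : normSq₂ A T = ∑ p : Fin n × Fin n, S p.1 p.2 ^ 2 := by
    have e1 : normSq₂ A T = ((A⁻¹ * T * A⁻¹) * T.transpose).trace := by
      have hs (a b : Fin n) : A⁻¹ a b = A⁻¹ b a := by
        rw [hinv, Matrix.mul_apply, Matrix.mul_apply]
        exact Finset.sum_congr rfl fun c _ => mul_comm _ _
      simp only [normSq₂, Matrix.trace, Matrix.diag, Matrix.mul_apply, Matrix.transpose_apply,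
        Finset.sum_mul]
      refine Finset.sum_congr rfl fun a _ => Finset.sum_congr rfl fun b _ => ?_
      rw [Finset.sum_comm]
      refine Finset.sum_congr rfl fun b' _ => Finset.sum_congr rfl fun a' _ => ?_
      rw [hs b b']; ring
    have e2 : ∑ p : Fin n × Fin n, S p.1 p.2 ^ 2 = (S * S.transpose).trace := by
      rw [Fintype.sum_prod_type]
      simp [Matrix.trace, Matrix.mul_apply, pow_two]
    rw [e1, e2, hS, hinv]
    simp only [Matrix.transpose_mul, Matrix.transpose_transpose]
    rw [show C * C.transpose * T * (C * C.transpose) * T.transpose =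
      C * (C.transpose * T * C * C.transpose * T.transpose) by simp only [Matrix.mul_assoc],
      Matrix.trace_mul_comm]
    simp only [Matrix.mul_assoc]
  have h4 := Finset.sum_mul_sq_le_sq_mul_sq Finset.univ (fun p : Fin n × Fin n => S p.1 p.2)
    fun p => w p.1 * w p.2
  have h5 : ∑ p : Fin n × Fin n, (w p.1 * w p.2) ^ 2 = quadForm A v ^ 2 := by
    rw [h1, pow_two (∑ i, w i ^ 2), Finset.sum_mul_sum, Fintype.sum_prod_type]
    exact Finset.sum_congr rfl fun i _ => Finset.sum_congr rfl fun j _ => by ring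
  rw [← h2, ← h3, h5] at h4
  have h6 : 0 ≤ quadForm A v := by rw [h1]; positivity
  have h7 := Real.le_sqrt_of_sq_le h4
  rwa [Real.sqrt_mul (by rw [h3]; positivity), Real.sqrt_sq h6] at h7

end

/-- No regularity and no normal coordinates are needed, because `fderiv` commutes with negation even
where the function is not differentiable. -/
theorem solitonOp_neg (G T : Euc n → Matrix (Fin n) (Fin n) ℝ) (u : Euc n → ℝ) (a b : Fin n)
    (x : Euc n) : solitonOp G u (fun y => -T y) a b x = -solitonOp G u T a b x := by
  have hpd (i : Fin n) (f : Euc n → ℝ) (x : Euc n) : pd i (fun y => -f y) x = -pd i f x := by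
    simp [pd, fderiv_fun_neg]
  have hcov (i a b : Fin n) : covDeriv₂ G (fun y => -T y) i a b = fun y => -covDeriv₂ G T i a b y := by
    funext y
    simp only [covDeriv₂, Matrix.neg_apply, hpd, mul_neg, ← neg_add, Finset.sum_neg_distrib]
    ring
  have hcov₂ (i j a b : Fin n) : covDeriv₂₂ G (fun y => -T y) i j a b x =
      -covDeriv₂₂ G T i j a b x := by
    simp only [covDeriv₂₂, hcov, hpd, mul_neg, ← neg_add, Finset.sum_neg_distrib]
    ring
  simp only [solitonOp, lichnerowicz, roughLaplacian, lieDeriv, hcov₂, hpd,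
    Matrix.neg_apply, mul_neg, neg_mul, Finset.sum_neg_distrib, ← neg_add]
  ring

end

section

variable {n : ℕ} {M : Type*} [TopologicalSpace M] [ChartedSpace (Euc n) M]
  {φ φ' : OpenPartialHomeomorph M (Euc n)} {y : Euc n}

theorem comp_neg (φ : OpenPartialHomeomorph M (Euc n)) (h : Tensor2 n M) :
    comp φ (fun x => -h x) = fun y => -comp φ h y := by
  funext y; ext i j; rfl

theorem quadForm_comp_transition (hφ : φ ∈ smoothCharts n M) (hφ' : φ' ∈ smoothCharts n M)
    (hy : y ∈ φ'.target) (hy' : φ'.symm y ∈ φ.source) (T : Tensor2 n M) (v : Euc n) :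
    quadForm (comp φ' T y) v =
      quadForm (comp φ T ((φ ∘ φ'.symm) y)) (fderiv ℝ (φ ∘ φ'.symm) y v) := by
  rw [← bilin_self, ← bilin_self, bilin_comp_transition hφ hφ' hy hy']

variable [IsManifold (𝓡 n) ∞ M] {g : Metric n M} {f : M → ℝ}

/-! ### The barrier `2 D²f - g / 2` -/

/-- The components of the tensor `2 D²f - g / 2`, which equals `2 Ric + g / 2` on a soliton. -/
def barrier (g : Metric n M) (f : M → ℝ) (φ : OpenPartialHomeomorph M (Euc n)) (y : Euc n) :
    Matrix (Fin n) (Fin n) ℝ :=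
  (2 : ℝ) • hess (comp φ g.inner) (f ∘ φ.symm) y + (-1 / 2 : ℝ) • comp φ g.inner y

theorem quadForm_barrier (hf : ContMDiff (𝓡 n) 𝓘(ℝ, ℝ) ∞ f) (hφ : φ ∈ smoothCharts n M)
    (hy : y ∈ φ.target) (v : Fin n → ℝ) :
    quadForm (barrier g f φ y) v =
      quadForm (Matrix.of fun i j =>
        lieDeriv (grad (comp φ g.inner) (f ∘ φ.symm)) (comp φ g.inner) i j y) v -
      1 / 2 * quadForm (comp φ g.inner y) v := by
  have h : (Matrix.of fun i j =>
      lieDeriv (grad (comp φ g.inner) (f ∘ φ.symm)) (comp φ g.inner) i j y) =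
      (2 : ℝ) • hess (comp φ g.inner) (f ∘ φ.symm) y + (0 : ℝ) • comp φ g.inner y := by
    ext i j
    simp [(isMetricOn_comp g hφ).lieDeriv_grad_eq_hess (contDiffOn_comp_symm hf hφ) hy]
  rw [h, barrier, quadForm_add_smul, quadForm_add_smul]
  ring

/-- The barrier is `ℒ_∇f g - g/2`, and both summands transform as tensors. -/
theorem quadForm_barrier_transition (hf : ContMDiff (𝓡 n) 𝓘(ℝ, ℝ) ∞ f)
    (hφ : φ ∈ smoothCharts n M) (hφ' : φ' ∈ smoothCharts n M)
    (hy : y ∈ φ'.target) (hy' : φ'.symm y ∈ φ.source) (v : Euc n) :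
    quadForm (barrier g f φ' y) v =
      quadForm (barrier g f φ ((φ ∘ φ'.symm) y)) (fderiv ℝ (φ ∘ φ'.symm) y v) := by
  have hτy : (φ ∘ φ'.symm) y ∈ φ.target := φ.map_source hy'
  rw [quadForm_barrier hf hφ' hy, quadForm_barrier hf hφ hτy,
    ← quadForm_comp_transition hφ hφ' hy hy']
  congr 1
  refine quadForm_lieDeriv_grad_pullback (isMetricOn_comp g hφ) (isMetricOn_comp g hφ')
    (contDiffOn_comp_symm hf hφ) (contDiffOn_comp_symm hf hφ') hy hτy
    ((contDiffAt_transition hφ hφ' hy hy').of_le ENat.LEInfty.out)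
    (surjective_fderiv_transition hφ hφ' hy hy') ?_ (comp_symm_transition hy hy') v
  filter_upwards [eventually_transition hy hy'] with z hz a b
  exact bilin_comp_transition hφ hφ' hz.1 hz.2 _ _ _

/-- The barrier is `2 Ric + g/2` with `Ric ≥ 0`. The sign of `Ric` is known in normal coordinates,
and the inequality is carried to other charts by the tensor law. -/
theorem half_metric_le_barrier (hn : 2 ≤ n) (hsol : IsExpandingGradientSoliton g f)
    (hpos : HasPositiveSectionalCurvature g) (hφ : φ ∈ smoothCharts n M) (hy : y ∈ φ.target)
    (v : Fin n → ℝ) : 1 / 2 * quadForm (comp φ g.inner y) v ≤ quadForm (barrier g f φ y) v := by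
  obtain ⟨φ', hφ', hp, hN⟩ := exists_normal_chart g (φ.symm y)
  obtain ⟨v, rfl⟩ : ∃ w : Euc n, v = w := ⟨WithLp.toLp 2 v, rfl⟩
  have hτy : (φ' ∘ φ.symm) y ∈ φ'.target := φ'.map_source hp
  rw [quadForm_barrier_transition hsol.1 hφ' hφ hy hp, quadForm_comp_transition hφ' hφ hy hp]
  set w : Fin n → ℝ := (fderiv ℝ (φ' ∘ φ.symm) y v).ofLp
  rw [quadForm_barrier hsol.1 hφ' hτy]
  have h : (Matrix.of fun i j =>
      lieDeriv (grad (comp φ' g.inner) (f ∘ φ'.symm)) (comp φ' g.inner) i j ((φ' ∘ φ.symm) y)) =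
      (2 : ℝ) • (Matrix.of fun i j => ricci (comp φ' g.inner) i j ((φ' ∘ φ.symm) y)) +
        (1 : ℝ) • comp φ' g.inner ((φ' ∘ φ.symm) y) := by
    ext i j
    simpa using (hsol.2 φ' hφ' _ hτy i j).symm
  have hric : 0 ≤ quadForm (Matrix.of fun i j =>
      ricci (comp φ' g.inner) i j ((φ' ∘ φ.symm) y)) w := by
    by_cases hw : w = 0
    · simp [hw, quadForm]
    · exact (hN.ricci_pos hn (fun a b hab => hpos φ' hφ' _ hτy a b hab) hw).le
  rw [h, quadForm_add_smul]
  linarith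

theorem barrier_pos (hn : 2 ≤ n) (hsol : IsExpandingGradientSoliton g f)
    (hpos : HasPositiveSectionalCurvature g) (hφ : φ ∈ smoothCharts n M) (hy : y ∈ φ.target)
    {v : Fin n → ℝ} (hv : v ≠ 0) : 0 < quadForm (barrier g f φ y) v :=
  (mul_pos one_half_pos (((isMetricOn_comp g hφ).posDef y hy).quadForm_pos hv)).trans_le
    (half_metric_le_barrier hn hsol hpos hφ hy v)

/-! ### The maximum principle -/

/-- The largest eigenvalue of `h` with respect to the barrier. -/
def maxEigenvalue (g : Metric n M) (f : M → ℝ) (h : Tensor2 n M) (x : M) : ℝ :=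
  maxRatio (comp (chartAt (Euc n) x) h (chartAt (Euc n) x x))
    (barrier g f (chartAt (Euc n) x) (chartAt (Euc n) x x))

/-- Allows the chart to be fixed while the point varies, which is needed both for continuity and for
working in a normal chart at the maximum. -/
theorem maxEigenvalue_eq (hn : 2 ≤ n) (hsol : IsExpandingGradientSoliton g f)
    (hpos : HasPositiveSectionalCurvature g) (h : Tensor2 n M) (hφ : φ ∈ smoothCharts n M) {x : M}
    (hx : x ∈ φ.source) : maxEigenvalue g f h x = maxRatio (comp φ h (φ x)) (barrier g f φ (φ x)) := by
  set ψ := chartAt (Euc n) x with hψdef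
  have hψ : ψ ∈ smoothCharts n M := chartAt_mem_smoothCharts x
  have hxψ : x ∈ ψ.source := mem_chart_source _ x
  have hy : ψ x ∈ ψ.target := ψ.map_source hxψ
  have hy' : ψ.symm (ψ x) ∈ φ.source := by rwa [ψ.left_inv hxψ]
  have hτ : (φ ∘ ψ.symm) (ψ x) = φ x := by simp [ψ.left_inv hxψ]
  refine maxRatio_congr (by omega) (fun v hv => barrier_pos hn hsol hpos hφ (φ.map_source hx) hv)
    (fun v hv => barrier_pos hn hsol hpos hψ hy hv) (surjective_fderiv_transition hφ hψ hy hy')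
    (fun v => ?_) fun v => ?_
  · rw [quadForm_comp_transition hφ hψ hy hy', hτ]
  · rw [quadForm_barrier_transition hsol.1 hφ hψ hy hy', hτ]

theorem continuous_maxEigenvalue (hn : 2 ≤ n) (hsol : IsExpandingGradientSoliton g f)
    (hpos : HasPositiveSectionalCurvature g) {h : Tensor2 n M}
    (hreg : ∀ φ ∈ smoothCharts n M, ∀ i j, ContDiffOn ℝ 2 (fun y => comp φ h y i j) φ.target) :
    Continuous (maxEigenvalue g f h) := by
  rw [continuous_iff_continuousAt]
  intro x
  set φ := chartAt (Euc n) x with hφdef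
  have hφ : φ ∈ smoothCharts n M := chartAt_mem_smoothCharts x
  have hx : x ∈ φ.source := mem_chart_source _ x
  have hG := isMetricOn_comp g hφ
  have hH := hG.smooth_hess (contDiffOn_comp_symm hsol.1 hφ)
  have h1 : ContinuousOn (fun y => maxRatio (comp φ h y) (barrier g f φ y)) φ.target := by
    rw [continuousOn_iff_continuous_domRestrict]
    refine continuous_maxRatio (A := fun y : φ.target => comp φ h y)
      (B := fun y : φ.target => barrier g f φ y)
      (fun i j => continuousOn_iff_continuous_domRestrict.1 (hreg φ hφ i j).continuousOn)
      (fun i j => continuousOn_iff_continuous_domRestrict.1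
        ((continuousOn_const.mul (hH i j).continuousOn).add
          (continuousOn_const.mul (hG.smooth i j).continuousOn)))
      fun y v hv => barrier_pos hn hsol hpos hφ y.2 hv
  have h2 : ContinuousAt ((fun y => maxRatio (comp φ h y) (barrier g f φ y)) ∘ φ) x :=
    (h1.continuousAt (φ.open_target.mem_nhds (φ.map_source hx))).comp (φ.continuousAt hx)
  refine h2.congr ?_
  filter_upwards [φ.open_source.mem_nhds hx] with z hz
  exact (maxEigenvalue_eq hn hsol hpos h hφ hz).symm

/-- Combine `h(v, v) ≤ |h| |v|²` with `|v|² ≤ 2 B(v, v)`. This is how decay of `|h|` controls the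
ratio at infinity. -/
theorem maxEigenvalue_le (hn : 2 ≤ n) (hsol : IsExpandingGradientSoliton g f)
    (hpos : HasPositiveSectionalCurvature g) (h : Tensor2 n M) (x : M) :
    maxEigenvalue g f h x ≤ 2 * tensorNorm g h x := by
  have hφ := chartAt_mem_smoothCharts (n := n) x
  have hy := (chartAt (Euc n) x).map_source (mem_chart_source _ x)
  refine le_of_maxRatio (by omega) (fun v hv => barrier_pos hn hsol hpos hφ hy hv) fun v => ?_
  have h1 := quadForm_le_sqrt_normSq₂ ((isMetricOn_comp g hφ).posDef _ hy)
    (comp (chartAt (Euc n) x) h (chartAt (Euc n) x x)) v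
  have h2 := half_metric_le_barrier hn hsol hpos hφ hy v
  have h3 := mul_le_mul_of_nonneg_left h2 (Real.sqrt_nonneg _ : 0 ≤ tensorNorm g h x)
  rw [← tensorNorm] at h1 h3
  linarith

/-- A solution of the Lichnerowicz equation that tends to zero at infinity is nonpositive. -/
theorem maxEigenvalue_nonpos (hn : 2 ≤ n) (hsol : IsExpandingGradientSoliton g f)
    (hnorm : IsNormalized g f) (hpos : HasPositiveSectionalCurvature g) {h : Tensor2 n M}
    (hreg : ∀ φ ∈ smoothCharts n M, ∀ i j, ContDiffOn ℝ 2 (fun y => comp φ h y i j) φ.target)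
    (hsymm : ∀ (x : M) (u v : TangentSpace (𝓡 n) x), h x u v = h x v u)
    (heq : SolvesLichnerowiczEquation g f h)
    (hdecay : Tendsto (tensorNorm g h) (cocompact M) (𝓝 0)) (x : M) :
    maxEigenvalue g f h x ≤ 0 := by
  by_contra! hx
  -- Where `|h|` is below half the positive value at `x`, the ratio is below that value. This holds
  -- outside a compact set, so the continuous ratio attains a global maximum.
  obtain ⟨p, hp⟩ := (continuous_maxEigenvalue hn hsol hpos hreg).exists_forall_ge' x (by
    filter_upwards [hdecay.eventually (gt_mem_nhds (half_pos hx))] with z hz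
    linarith [maxEigenvalue_le hn hsol hpos h z])
  obtain ⟨φ, hφ, hpφ, hN⟩ := exists_normal_chart g p
  have hG := isMetricOn_comp g hφ
  have hpt := φ.map_source hpφ
  have hsec (v w : Fin n → ℝ) (hvw : LinearIndependent ℝ ![v, w]) :=
    hpos φ hφ (φ p) hpt v w hvw
  have hspec (y : Euc n) (hy : y ∈ φ.target) := maxRatio_spec (A := comp φ h y) (by omega)
    fun v hv => barrier_pos hn hsol hpos hφ hy (v := v) hv
  have hmax (y : Euc n) (hy : y ∈ φ.target) :
      maxRatio (comp φ h y) (barrier g f φ y) ≤ maxEigenvalue g f h p := by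
    have h1 := hp (φ.symm y)
    rwa [maxEigenvalue_eq hn hsol hpos h hφ (φ.map_target hy), φ.right_inv hy] at h1
  obtain ⟨-, v, hv, hv'⟩ := hspec _ hpt
  rw [← maxEigenvalue_eq hn hsol hpos h hφ hpφ] at hv'
  -- Here `θ` is the maximal ratio at `p`, positive because it is at least the value at `x`, and `v`
  -- is a direction in which it is attained.
  refine not_touching hG hpt hN (contDiffOn_comp_symm hsol.1 hφ) (hsol.2 φ hφ) (hnorm φ hφ)
    (fun w hw => hN.ricci_pos hn hsec hw) (hN.curvForm_nonneg hsec)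
    (fun a b => (hreg φ hφ a b).contDiffAt (φ.open_target.mem_nhds hpt)) (fun a b => hsymm _ _ _)
    (heq φ hφ _ hpt) (hx.trans_le (hp x)) (fun y hy w => ?_) (ofLp_ne_zero hv) hv'
  refine ((hspec y hy).1 w).trans (mul_le_mul_of_nonneg_right (hmax y hy) ?_)
  by_cases hw : w = 0
  · simp [hw, quadForm]
  · exact (barrier_pos hn hsol hpos hφ hy hw).le

theorem apply_self_nonpos (hn : 2 ≤ n) (hsol : IsExpandingGradientSoliton g f)
    (hpos : HasPositiveSectionalCurvature g) {h : Tensor2 n M} {x : M}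
    (hle : maxEigenvalue g f h x ≤ 0) (a : TangentSpace (𝓡 n) x) : h x a a ≤ 0 := by
  set φ := chartAt (Euc n) x with hφdef
  have hφ : φ ∈ smoothCharts n M := chartAt_mem_smoothCharts x
  have hx : x ∈ φ.source := mem_chart_source _ x
  have hy := φ.map_source hx
  obtain ⟨v, hv⟩ : ∃ v : Euc n, (mfderiv (𝓡 n) (𝓡 n) φ.symm (φ x) v : Euc n) = a :=
    (mdifferentiable_of_mem_smoothCharts hφ).symm.mfderiv_surjective hy a
  have h1 : quadForm (comp φ h (φ x)) v = h x a a := by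
    rw [← bilin_self, bilin_comp]
    have key (q : M) (hq : q = x) (b : Euc n) (hb : b = a) : tensorEval h q b b = h x a a := by
      subst hq hb; rfl
    exact key _ (φ.left_inv hx) _ hv
  rw [← h1]
  refine ((maxRatio_spec (by omega) fun v hv =>
    barrier_pos hn hsol hpos hφ hy (v := v) hv).1 _).trans ?_
  refine mul_nonpos_of_nonpos_of_nonneg hle ?_
  by_cases hw : v = 0
  · simp [hw, quadForm]
  · exact (barrier_pos hn hsol hpos hφ hy (ofLp_ne_zero hw)).le

theorem tensorNorm_neg (g : Metric n M) (h : Tensor2 n M) :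
    tensorNorm g (fun x => -h x) = tensorNorm g h := by
  funext x
  simp [tensorNorm, comp_neg, normSq₂]

theorem SolvesLichnerowiczEquation.neg {h : Tensor2 n M} (heq : SolvesLichnerowiczEquation g f h) :
    SolvesLichnerowiczEquation g f fun x => -h x := by
  intro φ hφ y hy i j
  have h1 := solitonOp_neg (comp φ g.inner) (comp φ h) (f ∘ φ.symm) i j y
  rw [show solitonOp (comp φ g.inner) (f ∘ φ.symm) (comp φ h) i j y = 0 from heq φ hφ y hy i j,
    neg_zero] at h1
  rw [comp_neg]
  exact h1

/-- On a normalized expanding gradient soliton of positive sectional curvature, a solution of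
`Δ_L h + ℒ_X h - h = 0` that tends to zero at infinity vanishes. -/
theorem eq_zero_of_tendsto_zero (hn : 2 ≤ n) (hsol : IsExpandingGradientSoliton g f)
    (hnorm : IsNormalized g f) (hpos : HasPositiveSectionalCurvature g) {h : Tensor2 n M}
    (hreg : h.IsOfClass 2) (hsymm : ∀ (x : M) (u v : TangentSpace (𝓡 n) x), h x u v = h x v u)
    (heq : SolvesLichnerowiczEquation g f h)
    (hdecay : Tendsto (tensorNorm g h) (cocompact M) (𝓝 0)) (x : M) : h x = 0 := by
  have hreg' (φ : OpenPartialHomeomorph M (Euc n)) (hφ : φ ∈ smoothCharts n M) (i j : Fin n) :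
      ContDiffOn ℝ 2 (fun y => comp φ h y i j) φ.target := contDiffOn_comp hφ (k := 2) hreg i j
  have h1 := apply_self_nonpos hn hsol hpos
    (maxEigenvalue_nonpos hn hsol hnorm hpos hreg' hsymm heq hdecay x)
  have h2 := apply_self_nonpos hn hsol hpos (maxEigenvalue_nonpos hn hsol hnorm hpos
    (h := fun x => -h x) (fun φ hφ i j => by rw [comp_neg]; exact (hreg' φ hφ i j).neg)
    (fun x u v => congrArg Neg.neg (hsymm x u v)) heq.neg (by rwa [tensorNorm_neg]) x)
  have h3 (a : TangentSpace (𝓡 n) x) : h x a a = 0 :=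
    le_antisymm (h1 a) (neg_nonpos.1 (h2 a))
  ext a b
  -- Polarization: the diagonal values determine the symmetric form.
  have h4 := h3 (a + b)
  simp only [map_add, _root_.add_apply, h3, hsymm x b a] at h4
  change h x a b = 0
  linarith

end

end ExpSoliton

end

theorem proposition5p1 (n : ℕ) (hn : 3 ≤ n)
    {M : Type*} [TopologicalSpace M] [T2Space M] [SecondCountableTopology M] [ConnectedSpace M]
    [ChartedSpace (ExpSoliton.Euc n) M] [IsManifold (𝓡 n) ∞ M]
    (g : ExpSoliton.Metric n M) (f : M → ℝ)
    (hsol : ExpSoliton.IsExpandingGradientSoliton g f)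
    (hnorm : ExpSoliton.IsNormalized g f)
    (hpos : ExpSoliton.HasPositiveSectionalCurvature g)
    (hcone : ExpSoliton.IsAsymptoticallyConical g f)
    (h : ExpSoliton.Tensor2 n M) (hreg : h.IsOfClass 2)
    (hsymm : ∀ (x : M) (u v : TangentSpace (𝓡 n) x), h x u v = h x v u)
    (heq : ExpSoliton.SolvesLichnerowiczEquation g f h)
    (hdecay : Tendsto (ExpSoliton.tensorNorm g h) (cocompact M) (𝓝 0)) :
    ∀ x : M, h x = 0 :=
  ExpSoliton.eq_zero_of_tendsto_zero (by omega) hsol hnorm hpos hreg hsymm heq hdecay
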